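/- Let $P_l$ denote the path on $l$ vertices, let $kP_4\cup tP_2$ be the vertex-disjoint union of $k$ copies of $P_4$ and $t$ copies of $P_2$, and for a graph $H$ let the anti-Ramsey number $AR(n,H)$ be the maximum number of colors that are used in an edge-coloring of the complete graph $K_n$ (adjacent edges may have the same color) containing no rainbow copy of $H$, i.e. no (not necessarily induced) subgraph isomorphic to $H$ whose edges have pairwise distinct colors. For all integers $k,t\ge 1$ and $n=4k+2t$, \[ AR(n,kP_4\cup tP_2)=\begin{cases}\frac12(2k+t-2)(6k+3t+1)+1 & \text{when } 2k+t\le 6,\\ (2k+t-2)(4k+2t-3)+2 & \text{when } 2k+t\ge 7.\end{cases} \] -/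

import Mathlib

open SimpleGraph

/-- The disjoint union of `m` copies of the graph `G`. -/
def nCopies {V : Type*} (m : ℕ) (G : SimpleGraph V) : SimpleGraph (Fin m × V) :=
  (⊥ : SimpleGraph (Fin m)) □ G

/-- The linear forest `k P₄ ∪ t P₂`, where `P_l` is the path on `l` vertices. -/
def linearForestP4P2 (k t : ℕ) : SimpleGraph ((Fin k × Fin 4) ⊕ (Fin t × Fin 2)) :=
  nCopies k (pathGraph 4) ⊕g nCopies t (pathGraph 2)

/-- The edge-coloring `c` of the complete graph `K_n` contains a rainbow copy of `H`: a (not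
necessarily induced) subgraph isomorphic to `H` whose edges have pairwise distinct colors. -/
def HasRainbowCopy {W K : Type*} {n : ℕ} (c : TopEdgeLabeling (Fin n) K)
    (H : SimpleGraph W) : Prop :=
  ∃ f : Copy H (⊤ : SimpleGraph (Fin n)), Function.Injective (EdgeLabeling.pullback c f.toHom)

/-- The numbers `r` such that some edge-coloring of `K_n` that uses exactly `r` colors contains no
rainbow copy of `H`. -/
def rainbowFreeColorCounts {W : Type*} (n : ℕ) (H : SimpleGraph W) : Set ℕ :=
  {r | ∃ c : TopEdgeLabeling (Fin n) (Fin r), Function.Surjective c ∧ ¬ HasRainbowCopy c H}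

/-- The anti-Ramsey number `AR(n, H)`: the maximum number of colors in an edge-coloring of `K_n`
without a rainbow copy of `H`. -/
noncomputable def antiRamsey {W : Type*} (n : ℕ) (H : SimpleGraph W) : ℕ :=
  sSup (rainbowFreeColorCounts n H)

/-- The supremum in the definition of `antiRamsey` is a maximum as soon as some edge-coloring has
no rainbow copy of `H`, in particular whenever `antiRamsey n H` is not zero. -/
theorem isGreatest_antiRamsey {W : Type*} {n : ℕ} {H : SimpleGraph W}
    (h : (rainbowFreeColorCounts n H).Nonempty ∨ antiRamsey n H ≠ 0) :
    IsGreatest (rainbowFreeColorCounts n H) (antiRamsey n H) := by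
  have hne : (rainbowFreeColorCounts n H).Nonempty := by
    rcases h with h | h
    · exact h
    · by_contra h0
      rw [Set.not_nonempty_iff_eq_empty] at h0
      exact h (by simp [antiRamsey, h0])
  have hb : BddAbove (rainbowFreeColorCounts n H) := by
    refine ⟨Nat.card (⊤ : SimpleGraph (Fin n)).edgeSet, ?_⟩
    rintro r ⟨c, hc, -⟩
    simpa using Nat.card_le_card_of_surjective c hc
  exact ⟨Nat.sSup_mem hne hb, fun r hr => le_csSup hb hr⟩

/-! Put s = 2k + t, so that n = 2s. A copy of kP₄ ∪ tP₂ in K_n is spanning and contains a perfect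
matching, so a coloring without a rainbow perfect matching has no rainbow copy. Two such colorings
give the lower bounds: a rainbow set of all edges meeting s - 2 vertices plus one color (better for
3 ≤ s ≤ 6), and a rainbow clique on n - 3 vertices plus two colors (better for s ≥ 7).

For the upper bound, suppose that a coloring has more colors than both. A representing graph has one
edge of every color, so all its subgraphs are rainbow, and an edge may always be exchanged for
another edge of its color. Suppose that no representing graph has a perfect matching. By Tutte's
theorem each has a set S whose removal leaves at least |S| + 2 odd pieces; choose the graph and S
with |S| maximum. Maximality makes the pieces factor-critical, hence bridgeless, and an edge count
leaves only one shape: S is nonempty, there are exactly |S| + 2 pieces, and all but one of them (B)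
are single vertices (`exists_isCriticalPartition`). Bringing in an edge between B and a single
vertex w shows that S and the other single vertices cannot be matched robustly
(`IsCriticalPartition.not_isMatchable_deleteEdges`). This forces |S| nonadjacent pairs, too many for
the number of colors except for small S; |S| = 1 and |S| = 2 are excluded by explicit exchanges. So
some representing graph has a perfect matching (`exists_isRepresenting_isMatchable`).

Contracting the edges of this matching gives a dense graph on s vertices. It has a matching of size
k because 2k < s, and each of its edges links two contracted edges to a P₄
(`exists_injective_linearForest`). -/

/-! ### Matchings as covered vertex sets, and Tutte's theorem -/

section Matchable

open scoped Classical

variable {V : Type*} {G G' : SimpleGraph V}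

/-- `IsMatchable G X` says that `G` has a matching whose set of covered vertices is `X`. -/
inductive IsMatchable (G : SimpleGraph V) : Finset V → Prop
  | empty : IsMatchable G ∅
  | insert_pair {X : Finset V} {a b : V} (hab : G.Adj a b) (ha : a ∉ X) (hb : b ∉ X)
      (hX : IsMatchable G X) : IsMatchable G (insert a (insert b X))

namespace IsMatchable

theorem mono (h : G ≤ G') {X : Finset V} (hX : IsMatchable G X) : IsMatchable G' X := by
  induction hX with
  | empty => exact .empty
  | insert_pair hab ha hb _ ih => exact .insert_pair (h hab) ha hb ih

/-- A matching of `X` survives in every graph that contains the edges inside `X`. -/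
theorem mono_on {X : Finset V} (hX : IsMatchable G X)
    (h : ∀ a ∈ X, ∀ b ∈ X, G.Adj a b → G'.Adj a b) : IsMatchable G' X := by
  induction hX with
  | empty => exact .empty
  | insert_pair hab ha hb _ ih =>
    refine .insert_pair (h _ (by simp) _ (by simp) hab) ha hb (ih fun a ha b hb => ?_)
    exact h a (by simp [ha]) b (by simp [hb])

theorem pair {a b : V} (h : G.Adj a b) : IsMatchable G {a, b} := by
  simpa using insert_pair h (Finset.notMem_empty _) (Finset.notMem_empty _) .empty

theorem union {X Y : Finset V} (hX : IsMatchable G X) (hY : IsMatchable G Y)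
    (h : Disjoint X Y) : IsMatchable G (X ∪ Y) := by
  induction hX with
  | empty => simpa using hY
  | insert_pair hab ha hb _ ih =>
    rw [Finset.disjoint_insert_left, Finset.disjoint_insert_left] at h
    rw [Finset.insert_union, Finset.insert_union]
    exact .insert_pair hab (by simp [ha, h.1]) (by simp [hb, h.2.1]) (ih h.2.2)

/-- A matchable set contains an even number of vertices of every set that is closed under
adjacency inside it. -/
theorem even_card_of_closed {X Z : Finset V} (hX : IsMatchable G X) (hZ : Z ⊆ X)
    (h : ∀ a ∈ Z, ∀ b ∈ X, b ∉ Z → ¬ G.Adj a b) : Even Z.card := by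
  induction hX generalizing Z with
  | empty => simp [Finset.subset_empty.1 hZ]
  | @insert_pair X a b hab ha hb _ ih =>
    have key : ∀ Z' : Finset V, Z' ⊆ X → (∀ v ∈ X, v ∈ Z' ↔ v ∈ Z) → Even Z'.card := by
      intro Z' h1 h2
      refine ih h1 fun u hu v hv hvZ => h u ((h2 u (h1 hu)).1 hu) v (by simp [hv]) ?_
      exact fun hc => hvZ ((h2 v hv).2 hc)
    by_cases haZ : a ∈ Z
    · have hbZ : b ∈ Z := by
        by_contra hbZ
        exact h a haZ b (by simp) hbZ hab
      have h3 := key ((Z.erase a).erase b) (by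
        intro v hv
        have := hZ (Finset.mem_of_mem_erase (Finset.mem_of_mem_erase hv))
        simp at hv this
        tauto) (by
        intro v hv
        have h1 : v ≠ a := by rintro rfl; exact ha hv
        have h2 : v ≠ b := by rintro rfl; exact hb hv
        simp [h1, h2])
      have h4 : b ∈ Z.erase a := Finset.mem_erase.2 ⟨hab.ne.symm, hbZ⟩
      have h5 := Finset.card_erase_add_one h4
      have h6 := Finset.card_erase_add_one haZ
      rw [← h6, ← h5, add_assoc]
      exact h3.add even_two
    · have hbZ : b ∉ Z := by
        intro hbZ
        exact h b hbZ a (by simp) haZ hab.symm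
      refine key Z ?_ (fun _ _ => Iff.rfl)
      intro v hv
      have h1 : v ≠ a := by rintro rfl; exact haZ hv
      have h2 : v ≠ b := by rintro rfl; exact hbZ hv
      simpa [h1, h2] using hZ hv

/-- A nonempty matchable set contains an edge whose removal leaves a matchable set. -/
theorem exists_pair {X : Finset V} (hX : IsMatchable G X) (hne : X.Nonempty) :
    ∃ a b, G.Adj a b ∧ a ∈ X ∧ b ∈ X ∧ IsMatchable G ((X.erase a).erase b) := by
  cases hX with
  | empty => simp at hne
  | @insert_pair X a b hab ha hb h =>
    refine ⟨a, b, hab, by simp, by simp, ?_⟩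
    have : ((insert a (insert b X)).erase a).erase b = X := by
      rw [Finset.erase_insert (by simp [ha, hab.ne]), Finset.erase_insert hb]
    rwa [this]

/-- Adding an edge to a matching of the remaining vertices. -/
theorem of_erase {X : Finset V} {a b : V} (hab : G.Adj a b) (ha : a ∈ X) (hb : b ∈ X)
    (h : IsMatchable G ((X.erase a).erase b)) : IsMatchable G X := by
  have := insert_pair hab (by simp) (by simp) h
  have h2 : insert a (insert b ((X.erase a).erase b)) = X := by
    rw [Finset.insert_erase (Finset.mem_erase.2 ⟨hab.ne.symm, hb⟩), Finset.insert_erase ha]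
  rwa [h2] at this

theorem map {W : Type*} {H : SimpleGraph W} {X : Finset V} (hX : IsMatchable G X) (f : V → W)
    (hf : Set.InjOn f X) (h : ∀ a ∈ X, ∀ b ∈ X, G.Adj a b → H.Adj (f a) (f b)) :
    IsMatchable H (X.image f) := by
  induction hX with
  | empty => simpa using empty
  | @insert_pair X a b hab ha hb _ ih =>
    rw [Finset.image_insert, Finset.image_insert]
    refine insert_pair (h _ (by simp) _ (by simp) hab) ?_ ?_ (ih ?_ ?_)
    · intro hc
      obtain ⟨v, hv, hva⟩ := Finset.mem_image.1 hc
      have := hf (by simp [hv]) (by simp) hva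
      exact ha (this ▸ hv)
    · intro hc
      obtain ⟨v, hv, hva⟩ := Finset.mem_image.1 hc
      have := hf (by simp [hv]) (by simp) hva
      exact hb (this ▸ hv)
    · exact hf.mono (by intro v hv; simp at hv; simp [hv])
    · intro a ha b hb
      exact h a (by simp [ha]) b (by simp [hb])

/-- The edges of a matching of `X`, as a family of pairs that enumerates `X`. -/
theorem exists_family {X : Finset V} (hX : IsMatchable G X) :
    ∃ (ι : Type) (_ : Fintype ι) (m : ι × Fin 2 → V), Function.Injective m ∧
      Set.range m = X ∧ ∀ i, G.Adj (m (i, 0)) (m (i, 1)) := by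
  induction hX with
  | empty => exact ⟨Empty, inferInstance, fun i => i.1.elim, fun i => i.1.elim,
      by ext v; simp, fun i => i.elim⟩
  | @insert_pair X a b hab ha hb _ ih =>
    obtain ⟨ι, _, m, hm, hr, hadj⟩ := ih
    have hmX : ∀ x, m x ∈ X := fun x => by
      have : m x ∈ Set.range m := ⟨x, rfl⟩
      rwa [hr] at this
    refine ⟨Option ι, inferInstance,
      fun x => x.1.elim (if x.2 = 0 then a else b) fun i => m (i, x.2), ?_, ?_, ?_⟩
    · rintro ⟨_ | i, x⟩ ⟨_ | j, y⟩ hxy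
      · fin_cases x <;> fin_cases y <;> simp_all [hab.ne, hab.ne.symm]
      · exfalso
        have := hmX (j, y)
        simp only [Option.elim] at hxy
        rw [← hxy] at this
        split_ifs at this <;> contradiction
      · exfalso
        have := hmX (i, x)
        simp only [Option.elim] at hxy
        rw [hxy] at this
        split_ifs at this <;> contradiction
      · have := hm hxy
        simp_all
    · ext v
      constructor
      · rintro ⟨⟨_ | i, x⟩, rfl⟩
        · simp only [Option.elim]
          split_ifs <;> simp
        · have := hmX (i, x)
          simp [this]
      · intro hv
        simp only [Finset.coe_insert, Set.mem_insert_iff, Finset.mem_coe] at hv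
        rcases hv with rfl | rfl | hv
        · exact ⟨(none, 0), rfl⟩
        · exact ⟨(none, 1), rfl⟩
        · have : v ∈ Set.range m := by rw [hr]; exact hv
          obtain ⟨⟨i, x⟩, rfl⟩ := this
          exact ⟨(some i, x), rfl⟩
    · rintro (_ | i)
      · simpa using hab
      · exact hadj i

end IsMatchable

/-- A set on which a fixed-point-free involution moves vertices along edges is matchable. -/
theorem isMatchable_of_involution {f : V → V} (X : Finset V) (hX : ∀ v ∈ X, f v ∈ X)
    (hff : ∀ v ∈ X, f (f v) = v) (hadj : ∀ v ∈ X, G.Adj v (f v)) : IsMatchable G X := by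
  induction h : X.card using Nat.strong_induction_on generalizing X with
  | _ m ih =>
    rcases X.eq_empty_or_nonempty with rfl | ⟨v, hv⟩
    · exact .empty
    · refine .of_erase (hadj v hv) hv (hX v hv) (ih _ ?_ _ ?_ ?_ ?_ rfl)
      · rw [← h]
        exact (Finset.card_le_card (Finset.erase_subset _ _)).trans_lt
          (Finset.card_erase_lt_of_mem hv)
      · intro u hu
        simp only [Finset.mem_erase] at hu ⊢
        refine ⟨fun hc => hu.2.1 ?_, fun hc => hu.1 ?_, hX u hu.2.2⟩
        · rw [← hff u hu.2.2, hc, hff v hv]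
        · rw [← hff u hu.2.2, hc]
      · intro u hu
        exact hff u (Finset.mem_of_mem_erase (Finset.mem_of_mem_erase hu))
      · intro u hu
        exact hadj u (Finset.mem_of_mem_erase (Finset.mem_of_mem_erase hu))

/-- Two disjoint sets of equal size `q` with fewer than `q` nonadjacent pairs between them are
matched to each other. -/
theorem isMatchable_union_of_card_lt (q : ℕ) (S W : Finset V) (hd : Disjoint S W)
    (hS : S.card = q) (hW : W.card = q)
    (h : ((S ×ˢ W).filter fun p => ¬ G.Adj p.1 p.2).card < q ∨ q = 0) :
    IsMatchable G (S ∪ W) := by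
  induction q generalizing S W with
  | zero =>
    rw [Finset.card_eq_zero] at hS hW
    subst hS hW
    simpa using IsMatchable.empty
  | succ q ih =>
    have h : ((S ×ˢ W).filter fun p => ¬ G.Adj p.1 p.2).card < q + 1 := by simpa using h
    -- choose `w` with a nonneighbour in `S`, if there is one
    obtain ⟨w, hw, hw'⟩ : ∃ w ∈ W, (∀ p ∈ S ×ˢ W, G.Adj p.1 p.2) ∨ ∃ z ∈ S, ¬ G.Adj z w := by
      by_cases hall : ∀ p ∈ S ×ˢ W, G.Adj p.1 p.2
      · obtain ⟨w, hw⟩ : W.Nonempty := Finset.card_pos.1 (by omega)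
        exact ⟨w, hw, .inl hall⟩
      · push Not at hall
        obtain ⟨⟨z, w⟩, hp, hzw⟩ := hall
        rw [Finset.mem_product] at hp
        exact ⟨w, hp.2, .inr ⟨z, hp.1, hzw⟩⟩
    -- Without a neighbour in `S`, the vertex `w` alone would account for `q + 1` nonadjacent pairs.
    obtain ⟨z, hz, hzw⟩ : ∃ z ∈ S, G.Adj z w := by
      by_contra! hc
      have : (S.image fun z => (z, w)) ⊆ (S ×ˢ W).filter fun p => ¬ G.Adj p.1 p.2 := by
        intro p hp
        obtain ⟨z, hz, rfl⟩ := Finset.mem_image.1 hp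
        simp [hz, hw, hc z hz]
      have := Finset.card_le_card this
      rw [Finset.card_image_of_injective _ (fun a b hab => by simpa using hab)] at this
      omega
    have hzW : z ∉ W := Finset.disjoint_left.1 hd hz
    have hwS : w ∉ S := Finset.disjoint_right.1 hd hw
    -- Deleting `w` removes a nonadjacent pair, unless there is none at all, so the bound drops
    -- along with `q`.
    have key : IsMatchable G (S.erase z ∪ W.erase w) := by
      refine ih _ _ (hd.mono (Finset.erase_subset _ _) (Finset.erase_subset _ _))
        (by rw [Finset.card_erase_of_mem hz, hS]; rfl)
        (by rw [Finset.card_erase_of_mem hw, hW]; rfl) ?_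
      have hsub : ((S.erase z ×ˢ W.erase w).filter fun p => ¬ G.Adj p.1 p.2) ⊆
          (S ×ˢ W).filter fun p => ¬ G.Adj p.1 p.2 := by
        intro p hp
        simp only [Finset.mem_filter, Finset.mem_product, Finset.mem_erase] at hp ⊢
        tauto
      rcases hw' with hall | ⟨z', hz', hzw'⟩
      · have : ((S.erase z ×ˢ W.erase w).filter fun p => ¬ G.Adj p.1 p.2) = ∅ := by
          rw [Finset.eq_empty_iff_forall_notMem]
          intro p hp
          have := Finset.mem_filter.1 (hsub hp)
          exact this.2 (hall p this.1)
        rw [this]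
        simp only [Finset.card_empty]
        omega
      · have : ((S.erase z ×ˢ W.erase w).filter fun p => ¬ G.Adj p.1 p.2) ⊂
            (S ×ˢ W).filter fun p => ¬ G.Adj p.1 p.2 := by
          refine (Finset.ssubset_iff_of_subset hsub).2 ⟨(z', w), ?_, ?_⟩
          · simp [hz', hw, hzw']
          · simp
        have := Finset.card_lt_card this
        omega
    have h2 := IsMatchable.insert_pair hzw (X := S.erase z ∪ W.erase w)
      (by simp [hzW]) (by simp [hwS]) key
    convert h2 using 1
    ext v
    simp only [Finset.mem_union, Finset.mem_insert, Finset.mem_erase]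
    by_cases h1 : v = z
    · simp [h1, hz]
    · by_cases h2 : v = w <;> simp [h1, h2, hw]

/-- A set of size `2 p` with fewer than `p` nonadjacent pairs between any two of its disjoint
subsets is matchable. -/
theorem isMatchable_of_card_lt (p : ℕ) (X : Finset V) (hX : X.card = 2 * p)
    (h : ∀ A ⊆ X, ∀ B ⊆ X, Disjoint A B →
      ((A ×ˢ B).filter fun p => ¬ G.Adj p.1 p.2).card < p ∨ p = 0) :
    IsMatchable G X := by
  obtain ⟨A, hA, hAc⟩ := Finset.exists_subset_card_eq (s := X) (n := p) (by omega)
  have := isMatchable_union_of_card_lt (G := G) p A (X \ A) Finset.disjoint_sdiff hAc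
    (by rw [Finset.card_sdiff_of_subset hA]; omega)
    (h _ hA _ Finset.sdiff_subset Finset.disjoint_sdiff)
  rwa [Finset.union_sdiff_of_subset hA] at this

/-- Tutte's theorem for a set `X` of even size: if it is not matchable, then the removal of some
set `T` leaves at least `|T| + 2` odd pieces. -/
theorem exists_odd_pieces [Finite V] {X : Finset V} (hX : Even X.card) (h : ¬ IsMatchable G X) :
    ∃ (T : Finset V) (P : Finset (Finset V)), T ⊆ X ∧ T.card + 2 ≤ P.card ∧
      (∀ U ∈ P, U ⊆ X ∧ Odd U.card ∧ Disjoint U T ∧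
        ∀ u ∈ U, ∀ v ∈ X, v ∉ U → v ∉ T → ¬ G.Adj u v) ∧
      (P : Set (Finset V)).PairwiseDisjoint id := by
  have := Fintype.ofFinite V
  let H : SimpleGraph X := G.induce X
  have hno : ¬ ∃ M : Subgraph H, M.IsPerfectMatching := by
    rintro ⟨M, hM⟩
    apply h
    obtain ⟨hm, hs⟩ := hM
    choose f hf hfu using fun v : X => hm (hs v)
    have := isMatchable_of_involution (G := H) (f := f) Finset.univ (by simp)
      (fun v _ => (hfu _ _ (hf v).symm).symm) (fun v _ => (hf v).adj_sub)
    have := this.map (H := G) Subtype.val (Subtype.val_injective.injOn) (fun a _ b _ hab => hab)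
    convert this using 1
    ext v
    simp
  rw [tutte] at hno
  push Not at hno
  obtain ⟨u, hu⟩ := hno
  let D := (⊤ : H.Subgraph).deleteVerts u
  let pc : D.coe.ConnectedComponent → Finset V := fun c =>
    Finset.univ.filter fun v => ∃ h : v ∈ X, ∃ h' : (⟨v, h⟩ : X) ∈ D.verts,
      (⟨⟨v, h⟩, h'⟩ : D.verts) ∈ c.supp
  have hcard : ∀ c, (pc c).card = c.supp.ncard := by
    intro c
    rw [Set.ncard_eq_toFinset_card']
    symm
    refine Finset.card_bij (fun v _ => v.1.1) ?_ ?_ ?_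
    · intro v hv
      simp only [Set.mem_toFinset] at hv
      simp only [pc, Finset.mem_filter, Finset.mem_univ, true_and]
      exact ⟨v.1.2, v.2, hv⟩
    · intro v _ w _ hvw
      exact Subtype.ext (Subtype.ext hvw)
    · intro v hv
      simp only [pc, Finset.mem_filter, Finset.mem_univ, true_and] at hv
      obtain ⟨h, h', hc⟩ := hv
      exact ⟨⟨⟨v, h⟩, h'⟩, by simpa using hc, rfl⟩
  have hdisj : ∀ c c' v, v ∈ pc c → v ∈ pc c' → c = c' := by
    intro c c' v hv hv'
    simp only [pc, Finset.mem_filter, Finset.mem_univ, true_and] at hv hv'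
    obtain ⟨h, h', hc⟩ := hv
    obtain ⟨_, _, hc'⟩ := hv'
    rw [ConnectedComponent.mem_supp_iff] at hc hc'
    rw [← hc, ← hc']
  have hfin : D.coe.oddComponents.Finite := Set.toFinite _
  let T : Finset V := u.toFinset.image Subtype.val
  let P : Finset (Finset V) := hfin.toFinset.image pc
  have hTmem : ∀ v (h : v ∈ X), v ∈ T ↔ (⟨v, h⟩ : X) ∈ u := by
    intro v h
    simp [T, h]
  have hTcard : T.card = u.ncard := by
    rw [Finset.card_image_of_injective _ Subtype.val_injective, Set.ncard_eq_toFinset_card']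
  have hPodd : ∀ U ∈ P, ∃ c, Odd c.supp.ncard ∧ U = pc c := by
    intro U hU
    obtain ⟨c, hc, rfl⟩ := Finset.mem_image.1 hU
    exact ⟨c, by simpa using hc, rfl⟩
  have hPcard : P.card = D.coe.oddComponents.ncard := by
    rw [Finset.card_image_of_injOn, Set.ncard_eq_toFinset_card _ hfin]
    intro c hc c' hc' hcc
    have hodd : Odd c.supp.ncard := by simpa using hc
    have : 0 < (pc c).card := by rw [hcard]; exact hodd.pos
    obtain ⟨v, hv⟩ := Finset.card_pos.1 this
    exact hdisj c c' v hv (hcc ▸ hv)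
  -- Tutte's theorem gives an excess of 1. As `|X|` is even, `|P|` and `|T|` have the same parity,
  -- so the excess is at least 2.
  have hlt : T.card < P.card := by rw [hTcard, hPcard]; exact hu
  have hsub : ∀ U ∈ P, U ⊆ X ∧ Odd U.card ∧ Disjoint U T ∧
        ∀ u ∈ U, ∀ v ∈ X, v ∉ U → v ∉ T → ¬ G.Adj u v := by
    intro U hU
    obtain ⟨c, hc, rfl⟩ := hPodd U hU
    refine ⟨?_, by rwa [hcard], ?_, ?_⟩
    · intro v hv
      simp only [pc, Finset.mem_filter, Finset.mem_univ, true_and] at hv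
      exact hv.1
    · rw [Finset.disjoint_left]
      intro v hv hvT
      simp only [pc, Finset.mem_filter, Finset.mem_univ, true_and] at hv
      obtain ⟨h, h', -⟩ := hv
      rw [hTmem v h] at hvT
      simp [D, hvT] at h'
    · intro a ha b hbX hb hbT hab
      apply hb
      simp only [pc, Finset.mem_filter, Finset.mem_univ, true_and] at ha ⊢
      obtain ⟨h, h', hc⟩ := ha
      have hbD : (⟨b, hbX⟩ : X) ∈ D.verts := by
        simp only [D, Subgraph.deleteVerts_verts, Subgraph.verts_top, Set.mem_sdiff, Set.mem_univ,
          true_and]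
        rwa [← hTmem b hbX]
      refine ⟨hbX, hbD, ?_⟩
      rw [ConnectedComponent.mem_supp_iff] at hc ⊢
      rw [← hc]
      apply ConnectedComponent.sound
      apply Adj.reachable
      have h1 : (⟨a, h⟩ : X) ∉ u := by simpa [D] using h'
      have h2 : (⟨b, hbX⟩ : X) ∉ u := by simpa [D] using hbD
      simp [D, h1, h2, H, hab.symm]
  have hpd : (P : Set (Finset V)).PairwiseDisjoint id := by
    intro U hU U' hU' hne
    obtain ⟨c, -, rfl⟩ := hPodd U hU
    obtain ⟨c', -, rfl⟩ := hPodd U' hU'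
    rw [Function.onFun, Finset.disjoint_left]
    intro v hv hv'
    exact hne (by rw [hdisj c c' v hv hv'])
  refine ⟨T, P, ?_, ?_, hsub, hpd⟩
  · intro v hv
    simp only [T, Finset.mem_image] at hv
    obtain ⟨x, -, rfl⟩ := hv
    exact x.2
  · -- parity
    have hpar := odd_ncard_oddComponents D.coe
    have hnat : Nat.card D.verts = X.card - T.card := by
      rw [hTcard, Nat.card_coe_set_eq]
      simp only [D, Subgraph.deleteVerts_verts, Subgraph.verts_top]
      rw [← Set.compl_eq_univ_sdiff, Set.ncard_compl]
      simp
    have hle : T.card ≤ X.card := by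
      refine Finset.card_le_card ?_
      intro v hv
      simp only [T, Finset.mem_image] at hv
      obtain ⟨x, -, rfl⟩ := hv
      exact x.2
    rw [← hPcard, hnat] at hpar
    rcases hX with ⟨m, hm⟩
    rw [Nat.odd_iff, Nat.odd_iff] at hpar
    omega

end Matchable

/-! ### Representing graphs and exchanges of equally colored edges -/

section Representing

open scoped Classical

variable {V K : Type*}

/-- `G` contains exactly one edge of every color that `χ` uses on the complete graph. -/
structure IsRepresenting (χ : Sym2 V → K) (G : SimpleGraph V) : Prop where
  injOn : Set.InjOn χ G.edgeSet
  exists_eq : ∀ e : Sym2 V, ¬ e.IsDiag → ∃ g ∈ G.edgeSet, χ g = χ e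

/-- The graph `G` with the edge `g` exchanged for `e`. -/
def exchange (G : SimpleGraph V) (e g : Sym2 V) : SimpleGraph V :=
  fromEdgeSet (insert e (G.edgeSet \ {g}))

theorem exchange_adj {G : SimpleGraph V} {e g : Sym2 V} {a b : V} :
    (exchange G e g).Adj a b ↔ a ≠ b ∧ (s(a, b) = e ∨ G.Adj a b ∧ s(a, b) ≠ g) := by
  simp only [exchange, fromEdgeSet_adj, Set.mem_insert_iff, Set.mem_sdiff, mem_edgeSet,
    Set.mem_singleton_iff]
  tauto

theorem deleteEdges_le_exchange (G : SimpleGraph V) (e g : Sym2 V) :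
    G.deleteEdges {g} ≤ exchange G e g := by
  intro a b h
  rw [deleteEdges_adj] at h
  exact exchange_adj.2 ⟨h.1.ne, .inr ⟨h.1, h.2⟩⟩

theorem exchange_adj_new {G : SimpleGraph V} {g : Sym2 V} {a b : V} (h : a ≠ b) :
    (exchange G s(a, b) g).Adj a b :=
  exchange_adj.2 ⟨h, .inl rfl⟩

theorem exchange_adj_old {G : SimpleGraph V} {e g : Sym2 V} {a b : V} (h : G.Adj a b)
    (hg : s(a, b) ≠ g) : (exchange G e g).Adj a b :=
  exchange_adj.2 ⟨h.ne, .inr ⟨h, hg⟩⟩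

variable {χ : Sym2 V → K} {G : SimpleGraph V}

/-- This is the basic move of the upper bound: any missing edge can be brought in at the price of
the edge `g` of its color, and a perfect matching of the new graph would again be rainbow. -/
theorem IsRepresenting.exchange (hG : IsRepresenting χ G) {e g : Sym2 V} (he : ¬ e.IsDiag)
    (hg : g ∈ G.edgeSet) (hc : χ g = χ e) : IsRepresenting χ (exchange G e g) := by
  have hmem : ∀ x, x ∈ (_root_.exchange G e g).edgeSet ↔ x = e ∨ x ∈ G.edgeSet ∧ x ≠ g := by
    intro x
    simp only [_root_.exchange, edgeSet_fromEdgeSet, Set.mem_sdiff, Set.mem_insert_iff,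
      Set.mem_singleton_iff]
    constructor
    · exact fun h => h.1
    · intro h
      refine ⟨h, ?_⟩
      rcases h with rfl | h
      · exact he
      · exact G.not_isDiag_of_mem_edgeSet h.1
  refine ⟨?_, ?_⟩
  · intro x hx y hy hxy
    rw [hmem] at hx hy
    rcases hx with rfl | hx <;> rcases hy with rfl | hy
    · rfl
    · exact absurd (hG.injOn hy.1 hg (hxy ▸ hc.symm)) hy.2
    · exact absurd (hG.injOn hx.1 hg (hxy ▸ hc.symm)) hx.2
    · exact hG.injOn hx.1 hy.1 hxy
  · intro x hx
    obtain ⟨y, hy, hyx⟩ := hG.exists_eq x hx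
    by_cases h : y = g
    · exact ⟨e, (hmem e).2 (.inl rfl), by rw [← hyx, h, hc]⟩
    · exact ⟨y, (hmem y).2 (.inr ⟨hy, h⟩), hyx⟩

theorem exists_isRepresenting (χ : Sym2 V → K) : ∃ G, IsRepresenting χ G := by
  obtain ⟨t, ht, hbij⟩ := Set.exists_subset_bijOn {e : Sym2 V | ¬ e.IsDiag} χ
  have hset : (fromEdgeSet t).edgeSet = t := by
    rw [edgeSet_fromEdgeSet]
    ext e
    simp only [Set.mem_sdiff]
    exact ⟨fun h => h.1, fun h => ⟨h, ht h⟩⟩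
  refine ⟨fromEdgeSet t, by rw [hset]; exact hbij.injOn, ?_⟩
  intro e he
  have : χ e ∈ χ '' t := by rw [hbij.image_eq]; exact ⟨e, he, rfl⟩
  rw [hset]
  exact this

/-- The number of edges of a representing graph is the number of colors. -/
theorem IsRepresenting.ncard_edgeSet (hG : IsRepresenting χ G) :
    G.edgeSet.ncard = (χ '' {e | ¬ e.IsDiag}).ncard := by
  rw [← hG.injOn.ncard_image]
  congr 1
  ext k
  constructor
  · rintro ⟨e, he, rfl⟩
    exact ⟨e, G.not_isDiag_of_mem_edgeSet he, rfl⟩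
  · rintro ⟨e, he, rfl⟩
    exact hG.exists_eq e he

/-- The number of ordered pairs of adjacent vertices of a representing graph. -/
theorem IsRepresenting.card_adj [Fintype V] (hG : IsRepresenting χ G) :
    ((Finset.univ : Finset (V × V)).filter fun p => G.Adj p.1 p.2).card =
      2 * (χ '' {e | ¬ e.IsDiag}).ncard := by
  rw [← hG.ncard_edgeSet, ← G.coe_edgeFinset, Set.ncard_coe_finset,
    ← G.sum_degrees_eq_twice_card_edges]
  rw [Finset.card_filter, ← Finset.univ_product_univ, Finset.sum_product]
  refine Finset.sum_congr rfl fun v _ => ?_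
  rw [← Finset.card_filter, ← G.card_neighborFinset_eq_degree]
  congr 1
  ext w
  simp

end Representing

/-! ### Barriers of maximum size and their factor-critical pieces -/

section Barrier

open scoped Classical

variable {V K : Type*}

/-- The removal of `S` from `G` leaves at least `|S| + 2` odd pieces, the members of `P`, that are
not joined to other vertices. -/
structure IsBarrier (G : SimpleGraph V) (S : Finset V) (P : Finset (Finset V)) : Prop where
  card_le : S.card + 2 ≤ P.card
  odd : ∀ U ∈ P, Odd U.card
  disj : ∀ U ∈ P, Disjoint U S
  not_adj : ∀ U ∈ P, ∀ u ∈ U, ∀ v, v ∉ U → v ∉ S → ¬ G.Adj u v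
  pairwise : (P : Set (Finset V)).PairwiseDisjoint id

/-- `S` is a barrier of `G` and no barrier of a representing graph is larger. -/
structure IsMaxBarrier (χ : Sym2 V → K) (G : SimpleGraph V) (S : Finset V)
    (P : Finset (Finset V)) : Prop extends IsBarrier G S P where
  rep : IsRepresenting χ G
  le : ∀ G' S' P', IsRepresenting χ G' → IsBarrier G' S' P' → S'.card ≤ S.card

theorem exists_isBarrier [Fintype V] {G : SimpleGraph V} (hV : Even (Fintype.card V))
    (h : ¬ IsMatchable G Finset.univ) : ∃ S P, IsBarrier G S P := by
  obtain ⟨T, P, -, hc, hP, hd⟩ := exists_odd_pieces (by simpa using hV) h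
  exact ⟨T, P, hc, fun U hU => (hP U hU).2.1, fun U hU => (hP U hU).2.2.1,
    fun U hU u hu v hv hvT => (hP U hU).2.2.2 u hu v (Finset.mem_univ v) hv hvT, hd⟩

variable {χ : Sym2 V → K}

/-- The maximum is taken over the barriers of all representing graphs at once, so it still applies
after an exchange. -/
theorem exists_isMaxBarrier [Fintype V] (hV : Even (Fintype.card V))
    (h : ∀ G, IsRepresenting χ G → ¬ IsMatchable G Finset.univ) :
    ∃ G S P, IsMaxBarrier χ G S P := by
  let Q : ℕ → Prop := fun m => ∃ G S P, IsRepresenting χ G ∧ IsBarrier G S P ∧ S.card = m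
  have hQ : ∃ m, Q m := by
    obtain ⟨G, hG⟩ := exists_isRepresenting χ
    obtain ⟨S, P, hS⟩ := exists_isBarrier hV (h G hG)
    exact ⟨_, G, S, P, hG, hS, rfl⟩
  have hb : ∀ m, Q m → m ≤ Fintype.card V := by
    rintro m ⟨G, S, P, -, -, rfl⟩
    exact Finset.card_le_univ S
  obtain ⟨m, hm⟩ := hQ
  have hsp := Nat.findGreatest_spec (hb m hm) hm
  obtain ⟨G, S, P, hG, hS, hc⟩ := hsp
  refine ⟨G, S, P, hS, hG, fun G' S' P' hG' hS' => ?_⟩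
  rw [hc]
  exact Nat.le_findGreatest (hb _ ⟨G', S', P', hG', hS', rfl⟩) ⟨G', S', P', hG', hS', rfl⟩

/-- Pieces `P₁` outside `C` and the pieces `P'` that the removal of `T` leaves of `C` make `S ∪ T`
a barrier, if there are enough of them. -/
theorem IsBarrier.refine {G : SimpleGraph V} {S T C : Finset V} {P₁ P' : Finset (Finset V)}
    (hodd : ∀ U ∈ P₁, Odd U.card) (hdS : ∀ U ∈ P₁, Disjoint U S) (hdC : ∀ U ∈ P₁, Disjoint U C)
    (hadj : ∀ U ∈ P₁, ∀ u ∈ U, ∀ v, v ∉ U → v ∉ S → ¬ G.Adj u v)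
    (hpd : (P₁ : Set (Finset V)).PairwiseDisjoint id)
    (hCS : Disjoint C S) (hTC : T ⊆ C)
    (hC : ∀ u ∈ C, ∀ v, v ∉ C → v ∉ S → ¬ G.Adj u v)
    (hP' : ∀ U ∈ P', U ⊆ C ∧ Odd U.card ∧ Disjoint U T ∧
        ∀ u ∈ U, ∀ v ∈ C, v ∉ U → v ∉ T → ¬ G.Adj u v)
    (hpd' : (P' : Set (Finset V)).PairwiseDisjoint id)
    (hcard : S.card + T.card + 2 ≤ P₁.card + P'.card) :
    IsBarrier G (S ∪ T) (P₁ ∪ P') where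
  card_le := by
    rw [Finset.card_union_of_disjoint (hCS.symm.mono_right hTC), Finset.card_union_of_disjoint]
    · exact hcard
    · rw [Finset.disjoint_left]
      intro U hU hU'
      have h1 := hdC U hU
      obtain ⟨v, hv⟩ := Finset.card_pos.1 (hodd U hU).pos
      exact Finset.disjoint_left.1 h1 hv ((hP' U hU').1 hv)
  odd := by
    intro U hU
    rcases Finset.mem_union.1 hU with h | h
    · exact hodd U h
    · exact (hP' U h).2.1
  disj := by
    intro U hU
    rw [Finset.disjoint_union_right]
    rcases Finset.mem_union.1 hU with h | h
    · exact ⟨hdS U h, (hdC U h).mono_right hTC⟩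
    · exact ⟨hCS.mono_left (hP' U h).1, (hP' U h).2.2.1⟩
  not_adj := by
    intro U hU u hu v hvU hv
    rw [Finset.mem_union, not_or] at hv
    rcases Finset.mem_union.1 hU with h | h
    · exact hadj U h u hu v hvU hv.1
    · by_cases hvC : v ∈ C
      · exact (hP' U h).2.2.2 u hu v hvC hvU hv.2
      · exact hC u ((hP' U h).1 hu) v hvC hv.1
  pairwise := by
    intro U hU U' hU' hne
    rw [Finset.mem_coe, Finset.mem_union] at hU hU'
    rcases hU with h | h <;> rcases hU' with h' | h'
    · exact hpd h h' hne
    · exact (hdC U h).mono_right (hP' U' h').1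
    · exact ((hdC U' h').mono_right (hP' U h).1).symm
    · exact hpd' h h' hne

/-- The pieces of a maximum barrier are factor-critical. -/
theorem IsMaxBarrier.isMatchable_erase [Finite V] {G : SimpleGraph V} {S : Finset V}
    {P : Finset (Finset V)} (h : IsMaxBarrier χ G S P) {C : Finset V} (hC : C ∈ P) {v : V}
    (hv : v ∈ C) : IsMatchable G (C.erase v) := by
  by_contra hno
  have heven : Even (C.erase v).card := by
    have := h.odd C hC
    rw [Finset.card_erase_of_mem hv]
    exact Nat.Odd.sub_odd this odd_one
  obtain ⟨T, P', hT, hc, hP', hd⟩ := exists_odd_pieces heven hno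
  have hvS : v ∉ S := Finset.disjoint_left.1 (h.disj C hC) hv
  have hvT : v ∉ T := fun hc => by simpa using hT hc
  -- The barrier grows by `|T| + 1`; the piece `C` is lost and at least `|T| + 2` pieces are gained,
  -- so the excess of 2 persists and maximality is violated.
  have hb := IsBarrier.refine (G := G) (S := S) (T := insert v T) (C := C) (P₁ := P.erase C)
    (P' := P') (fun U hU => h.odd U (Finset.mem_of_mem_erase hU))
    (fun U hU => h.disj U (Finset.mem_of_mem_erase hU))
    (fun U hU => h.pairwise (Finset.mem_of_mem_erase hU) hC (Finset.ne_of_mem_erase hU))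
    (fun U hU => h.not_adj U (Finset.mem_of_mem_erase hU))
    (h.pairwise.subset (by intro U hU; exact Finset.mem_of_mem_erase hU))
    (h.disj C hC)
    (Finset.insert_subset hv (hT.trans (Finset.erase_subset _ _)))
    (h.not_adj C hC)
    (by
      intro U hU
      obtain ⟨h1, h2, h3, h4⟩ := hP' U hU
      refine ⟨h1.trans (Finset.erase_subset _ _), h2, ?_, ?_⟩
      · rw [Finset.disjoint_insert_right]
        exact ⟨fun hc => by simpa using h1 hc, h3⟩
      · intro a ha b hb hbU hbT
        rw [Finset.mem_insert, not_or] at hbT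
        exact h4 a ha b (Finset.mem_erase.2 ⟨hbT.1, hb⟩) hbU hbT.2) hd
    (by
      rw [Finset.card_insert_of_notMem hvT, Finset.card_erase_of_mem hC]
      have := h.card_le
      omega)
  have h1 := h.le _ _ _ h.rep hb
  rw [Finset.card_union_of_disjoint, Finset.card_insert_of_notMem hvT] at h1
  · omega
  · exact (h.disj C hC).symm.mono_right (Finset.insert_subset hv (hT.trans (Finset.erase_subset _ _)))

/-- The pieces of a maximum barrier `S` may be taken to cover all vertices outside `S`. -/
theorem IsMaxBarrier.exists_cover [Fintype V] {G : SimpleGraph V} {S : Finset V}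
    {P : Finset (Finset V)} (h : IsMaxBarrier χ G S P) :
    ∃ P', IsMaxBarrier χ G S P' ∧ ∀ v, v ∉ S → ∃ U ∈ P', v ∈ U := by
  let Z : Finset V := Finset.univ.filter fun v => v ∉ S ∧ ∀ U ∈ P, v ∉ U
  have hZ : ∀ v, v ∈ Z ↔ v ∉ S ∧ ∀ U ∈ P, v ∉ U := fun v => by simp [Z]
  have hZS : Disjoint Z S := by
    rw [Finset.disjoint_left]
    exact fun v hv => ((hZ v).1 hv).1
  have hdZ : ∀ U ∈ P, Disjoint U Z := by
    intro U hU
    rw [Finset.disjoint_right]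
    exact fun v hv => ((hZ v).1 hv).2 U hU
  have hZadj : ∀ u ∈ Z, ∀ v, v ∉ Z → v ∉ S → ¬ G.Adj u v := by
    intro u hu v hv hvS huv
    rw [hZ] at hu hv
    have : ∃ U ∈ P, v ∈ U := by
      by_contra! hc
      exact hv ⟨hvS, hc⟩
    obtain ⟨U, hU, hvU⟩ := this
    exact h.not_adj U hU v hvU u (hu.2 U hU) hu.1 huv.symm
  -- If the uncovered set `Z` is odd, it is one more piece. If it is even and contains `z`, moving
  -- `z` into `S` makes the rest of `Z` an odd piece, and the barrier gets larger.
  rcases Nat.even_or_odd Z.card with hev | hodd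
  · rcases Z.eq_empty_or_nonempty with hemp | ⟨z, hz⟩
    · refine ⟨P, h, fun v hv => ?_⟩
      by_contra! hc
      have : v ∈ Z := (hZ v).2 ⟨hv, hc⟩
      simp [hemp] at this
    · exfalso
      have hb := IsBarrier.refine (G := G) (S := S) (T := {z}) (C := Z) (P₁ := P)
        (P' := {Z.erase z}) h.odd h.disj hdZ h.not_adj h.pairwise hZS (by simpa using hz) hZadj
        (by
          intro U hU
          rw [Finset.mem_singleton] at hU
          subst hU
          refine ⟨Finset.erase_subset _ _, ?_, by simp, ?_⟩
          · rw [Finset.card_erase_of_mem hz]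
            have := Finset.card_pos.2 ⟨z, hz⟩
            rcases hev with ⟨m, hm⟩
            exact ⟨m - 1, by omega⟩
          · intro u _ v hv hvU hvz
            exact absurd (Finset.mem_erase.2 ⟨by simpa using hvz, hv⟩) hvU)
        (by simp)
        (by
          have := h.card_le
          simp
          omega)
      have h1 := h.le _ _ _ h.rep hb
      rw [Finset.card_union_of_disjoint] at h1
      · simp at h1
      · exact hZS.symm.mono_right (by simpa using hz)
  · have hb := IsBarrier.refine (G := G) (S := S) (T := ∅) (C := Z) (P₁ := P)
        (P' := {Z}) h.odd h.disj hdZ h.not_adj h.pairwise hZS (by simp) hZadj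
        (by
          intro U hU
          rw [Finset.mem_singleton] at hU
          subst hU
          exact ⟨subset_rfl, hodd, by simp, fun u _ v hv hvU => absurd hv hvU⟩)
        (by simp)
        (by
          have := h.card_le
          simp
          omega)
    rw [Finset.union_empty] at hb
    refine ⟨P ∪ {Z}, ⟨hb, h.rep, h.le⟩, fun v hv => ?_⟩
    by_cases hc : ∃ U ∈ P, v ∈ U
    · obtain ⟨U, hU, hvU⟩ := hc
      exact ⟨U, by simp [hU], hvU⟩
    · push Not at hc
      exact ⟨Z, by simp, (hZ v).2 ⟨hv, hc⟩⟩

/-- A factor-critical set has no bridge: a subset that at most one edge leaves is trivial. -/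
theorem eq_empty_or_eq_of_factorCritical {G : SimpleGraph V} {C U : Finset V} (hodd : Odd C.card)
    (hfc : ∀ v ∈ C, IsMatchable G (C.erase v)) (g : Sym2 V) (hU : U ⊆ C)
    (h : ∀ u ∈ U, ∀ v ∈ C, v ∉ U → G.Adj u v → s(u, v) = g) : U = ∅ ∨ U = C := by
  -- As `|C|` is odd, one of the two sides is even. Let `v` be the end of `g` in the even side `Z`:
  -- the matching of `C \ {v}` would have to match the odd set `Z \ {v}` within itself.
  have key : ∀ Z Z' : Finset V, Z ∪ Z' = C → Disjoint Z Z' → Even Z.card → Z.Nonempty →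
      (∀ u ∈ Z, ∀ v ∈ Z', G.Adj u v → s(u, v) = g) → False := by
    intro Z Z' hZZ hd hev hne hadj
    obtain ⟨v, hv, hvadj⟩ : ∃ v ∈ Z, ∀ u ∈ Z, ∀ w ∈ Z', G.Adj u w → u = v := by
      by_cases hex : ∃ u ∈ Z, ∃ w ∈ Z', G.Adj u w
      · obtain ⟨u, hu, w, hw, huw⟩ := hex
        refine ⟨u, hu, fun u' hu' w' hw' huw' => ?_⟩
        have h1 := hadj u hu w hw huw
        have h2 := hadj u' hu' w' hw' huw'
        rw [← h1, Sym2.eq_iff] at h2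
        rcases h2 with h2 | h2
        · exact h2.1
        · exact absurd hw (Finset.disjoint_left.1 hd (h2.1 ▸ hu'))
      · push Not at hex
        obtain ⟨v, hv⟩ := hne
        exact ⟨v, hv, fun u hu w hw huw => absurd huw (hex u hu w hw)⟩
    have hvC : v ∈ C := hZZ ▸ Finset.mem_union_left _ hv
    have h1 := (hfc v hvC).even_card_of_closed (Z := Z.erase v)
      (Finset.erase_subset_erase _ (hZZ ▸ Finset.subset_union_left)) (by
        intro a ha b hb hbZ hab
        rw [Finset.mem_erase] at ha hb hbZ
        have hbZ' : b ∈ Z' := by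
          have := hb.2
          rw [← hZZ, Finset.mem_union] at this
          rcases this with h | h
          · exact absurd ⟨hb.1, h⟩ hbZ
          · exact h
        exact ha.1 (hvadj a ha.2 b hbZ' hab))
    rw [Finset.card_erase_of_mem hv] at h1
    have := Finset.card_pos.2 ⟨v, hv⟩
    rw [Nat.even_iff] at h1 hev
    omega
  by_contra! hc
  have hne : (C \ U).Nonempty := by
    rw [Finset.sdiff_nonempty]
    exact fun h => hc.2 (hU.antisymm h)
  have hcard := Finset.card_sdiff_add_card_eq_card hU
  rcases Nat.even_or_odd U.card with hev | ho
  · refine key U (C \ U) (Finset.union_sdiff_of_subset hU) Finset.disjoint_sdiff hev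
      hc.1 ?_
    intro u hu v hv
    rw [Finset.mem_sdiff] at hv
    exact h u hu v hv.1 hv.2
  · refine key (C \ U) U (Finset.sdiff_union_of_subset hU) Finset.sdiff_disjoint ?_ hne ?_
    · rw [Nat.odd_iff] at ho hodd
      rw [Nat.even_iff]
      omega
    · intro u hu v hv huv
      rw [Finset.mem_sdiff] at hu
      rw [Sym2.eq_swap]
      exact h v hv u hu.1 hu.2 huv.symm

end Barrier

/-! ### The critical partition and the nonadjacent pairs it forces -/

section CriticalPartition

open scoped Classical

variable {V K : Type*}

/-- The vertex partition `S ∪ W ∪ B` that a maximum barrier `S` gives when all of its pieces but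
one, the set `B`, are singletons, which form `W`. -/
structure IsCriticalPartition (χ : Sym2 V → K) (G : SimpleGraph V) (S W B : Finset V) : Prop where
  rep : IsRepresenting χ G
  le : ∀ G' S' P', IsRepresenting χ G' → IsBarrier G' S' P' → S'.card ≤ S.card
  disjSW : Disjoint S W
  disjSB : Disjoint S B
  disjWB : Disjoint W B
  cover : ∀ v, v ∈ S ∨ v ∈ W ∨ v ∈ B
  card_W : W.card = S.card + 1
  odd_B : Odd B.card
  not_adj : ∀ w ∈ W, ∀ v, v ∉ S → ¬ G.Adj w v
  matchable : ∀ v ∈ B, IsMatchable G (B.erase v)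

variable {χ : Sym2 V → K} {G : SimpleGraph V} {S W B : Finset V}

theorem pairwiseDisjoint_image_singleton (W : Finset V) :
    ((W.image fun v => ({v} : Finset V)) : Set (Finset V)).PairwiseDisjoint id := by
  intro U hU U' hU' hne
  rw [Finset.mem_coe, Finset.mem_image] at hU hU'
  obtain ⟨u, -, rfl⟩ := hU
  obtain ⟨u', -, rfl⟩ := hU'
  simp only [Function.onFun, id, Finset.disjoint_singleton]
  rintro rfl
  exact hne rfl

/-- Exchange `g` for the edge `wx`. If `S ∪ W \ {w}` were still matched, `B ∪ {w}` could not be, and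
Tutte's theorem would give a set `T` inside it that enlarges the barrier `S`; so `T` is empty. But
`B ∪ {w}` is even and does not split: the factor-critical set `B` stays in one piece without `g`,
and `wx` attaches `w` to it. -/
theorem IsCriticalPartition.not_isMatchable_deleteEdges [Fintype V]
    (h : IsCriticalPartition χ G S W B)
    (hbad : ∀ G, IsRepresenting χ G → ¬ IsMatchable G Finset.univ) {w x : V} (hw : w ∈ W)
    (hx : x ∈ B) {g : Sym2 V} (hg : g ∈ G.edgeSet) (hc : χ g = χ s(w, x)) :
    ¬ IsMatchable (G.deleteEdges {g}) (S ∪ W.erase w) := by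
  intro hm
  have hwB : w ∉ B := Finset.disjoint_left.1 h.disjWB hw
  have hwS : w ∉ S := Finset.disjoint_right.1 h.disjSW hw
  have hwx : w ≠ x := by rintro rfl; exact hwB hx
  set G' := exchange G s(w, x) g with hG'
  have hrep : IsRepresenting χ G' := h.rep.exchange (by simpa using hwx) hg hc
  have hE : ¬ IsMatchable G' (insert w B) := by
    intro hE
    refine hbad G' hrep ?_
    have hd : Disjoint (S ∪ W.erase w) (insert w B) := by
      rw [Finset.disjoint_insert_right, Finset.disjoint_union_left]
      refine ⟨by simp [hwS], h.disjSB, h.disjWB.mono_left (Finset.erase_subset _ _)⟩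
    convert (hm.mono (deleteEdges_le_exchange G s(w, x) g)).union hE hd using 1
    ext v
    have := h.cover v
    simp only [Finset.mem_univ, Finset.mem_union, Finset.mem_erase, Finset.mem_insert, true_iff]
    tauto
  have hev : Even (insert w B).card := by
    rw [Finset.card_insert_of_notMem hwB]
    exact h.odd_B.add_one
  obtain ⟨T, P', hT, hcard, hP', hd⟩ := exists_odd_pieces hev hE
  have hnadj : ∀ u ∈ W, u ≠ w → ∀ v, v ∉ S → ¬ G'.Adj u v := by
    intro u hu huw v hv huv
    rw [hG', exchange_adj] at huv
    rcases huv.2 with h1 | h1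
    · rw [Sym2.eq_iff] at h1
      rcases h1 with h1 | h1
      · exact huw h1.1
      · exact Finset.disjoint_left.1 h.disjWB hu (h1.1 ▸ hx)
    · exact h.not_adj u hu v hv h1.1
  have hb := IsBarrier.refine (G := G') (S := S) (T := T) (C := insert w B)
    (P₁ := (W.erase w).image fun v => ({v} : Finset V)) (P' := P')
    (by
      intro U hU
      obtain ⟨u, -, rfl⟩ := Finset.mem_image.1 hU
      simp)
    (by
      intro U hU
      obtain ⟨u, hu, rfl⟩ := Finset.mem_image.1 hU
      rw [Finset.disjoint_singleton_left]
      exact Finset.disjoint_right.1 h.disjSW (Finset.mem_of_mem_erase hu))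
    (by
      intro U hU
      obtain ⟨u, hu, rfl⟩ := Finset.mem_image.1 hU
      rw [Finset.disjoint_singleton_left, Finset.mem_insert, not_or]
      exact ⟨Finset.ne_of_mem_erase hu,
        Finset.disjoint_left.1 h.disjWB (Finset.mem_of_mem_erase hu)⟩)
    (by
      intro U hU a ha v _ hvS
      obtain ⟨u, hu, rfl⟩ := Finset.mem_image.1 hU
      rw [Finset.mem_singleton] at ha
      subst ha
      exact hnadj a (Finset.mem_of_mem_erase hu) (Finset.ne_of_mem_erase hu) v hvS)
    (pairwiseDisjoint_image_singleton _)
    (by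
      rw [Finset.disjoint_insert_left]
      exact ⟨hwS, h.disjSB.symm⟩)
    hT
    (by
      intro u hu v hv hvS huv
      rw [Finset.mem_insert, not_or] at hv
      have hvW : v ∈ W := by
        have := h.cover v
        tauto
      refine hnadj v hvW hv.1 u ?_ huv.symm
      rw [Finset.mem_insert] at hu
      rcases hu with rfl | hu
      · exact hwS
      · exact Finset.disjoint_right.1 h.disjSB hu)
    hP' hd
    (by
      rw [Finset.card_image_of_injective _ (Finset.singleton_injective),
        Finset.card_erase_of_mem hw, h.card_W]
      omega)
  have h1 := h.le _ _ _ hrep hb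
  rw [Finset.card_union_of_disjoint] at h1
  swap
  · refine Disjoint.mono_right hT ?_
    rw [Finset.disjoint_insert_right]
    exact ⟨hwS, h.disjSB⟩
  have hT0 : T = ∅ := Finset.card_eq_zero.1 (by omega)
  subst hT0
  obtain ⟨U, hU⟩ : P'.Nonempty := Finset.card_pos.1 (by omega)
  obtain ⟨hUE, hUodd, -, hUadj⟩ := hP' U hU
  have hwxU : w ∈ U ↔ x ∈ U := by
    have hadj : G'.Adj w x := exchange_adj_new hwx
    constructor
    · intro hwU
      by_contra hxU
      exact hUadj w hwU x (by simp [hx]) hxU (by simp) hadj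
    · intro hxU
      by_contra hwU
      exact hUadj x hxU w (by simp) hwU (by simp) hadj.symm
  have h2 := eq_empty_or_eq_of_factorCritical (U := U ∩ B) h.odd_B h.matchable g
    Finset.inter_subset_right (by
      intro u hu v hv hvU huv
      rw [Finset.mem_inter] at hu hvU
      by_contra hne
      exact hUadj u hu.1 v (by simp [hv]) (fun hc => hvU ⟨hc, hv⟩) (by simp)
        (exchange_adj_old huv hne))
  rcases h2 with h2 | h2
  · have hxU : x ∉ U := fun hc => by
      have : x ∈ U ∩ B := Finset.mem_inter.2 ⟨hc, hx⟩
      simp [h2] at this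
    obtain ⟨u, hu⟩ := Finset.card_pos.1 hUodd.pos
    have := hUE hu
    rw [Finset.mem_insert] at this
    rcases this with rfl | hB
    · exact hxU (hwxU.1 hu)
    · have : u ∈ U ∩ B := Finset.mem_inter.2 ⟨hu, hB⟩
      simp [h2] at this
  · have hBU : B ⊆ U := by
      rw [← h2]
      exact Finset.inter_subset_left
    have : U = insert w B := by
      refine hUE.antisymm (Finset.insert_subset (hwxU.2 (hBU hx)) hBU)
    rw [this] at hUodd
    exact (Nat.not_odd_iff_even.2 hev) hUodd

/-- If fewer than `|S|` pairs between `S` and `W` are nonadjacent, there is a rainbow perfect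
matching. -/
theorem IsCriticalPartition.card_le_card_nonadj [Fintype V]
    (h : IsCriticalPartition χ G S W B)
    (hbad : ∀ G, IsRepresenting χ G → ¬ IsMatchable G Finset.univ) (hS : 2 ≤ S.card) :
    S.card ≤ ((S ×ˢ W).filter fun p => ¬ G.Adj p.1 p.2).card := by
  by_contra! hlt
  set M := (S ×ˢ W).filter fun p => ¬ G.Adj p.1 p.2 with hM
  -- Choosing `w` in a nonadjacent pair leaves at most `|S| - 2` of them. Deleting `g` adds at most
  -- one, and fewer than `|S|` still allow a matching.
  obtain ⟨w, hw, hcard⟩ : ∃ w ∈ W,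
      ((S ×ˢ W.erase w).filter fun p => ¬ G.Adj p.1 p.2).card + 2 ≤ S.card := by
    rcases M.eq_empty_or_nonempty with h0 | ⟨⟨z, w⟩, hzw⟩
    · obtain ⟨w, hw⟩ : W.Nonempty := Finset.card_pos.1 (by rw [h.card_W]; omega)
      refine ⟨w, hw, ?_⟩
      have : ((S ×ˢ W.erase w).filter fun p => ¬ G.Adj p.1 p.2) ⊆ M := by
        intro p hp
        simp only [hM, Finset.mem_filter, Finset.mem_product, Finset.mem_erase] at hp ⊢
        tauto
      have := Finset.card_le_card this
      rw [h0] at this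
      simp only [Finset.card_empty] at this
      omega
    · have hzw' := hzw
      rw [hM, Finset.mem_filter, Finset.mem_product] at hzw'
      refine ⟨w, hzw'.1.2, ?_⟩
      have : ((S ×ˢ W.erase w).filter fun p => ¬ G.Adj p.1 p.2) ⊂ M := by
        refine (Finset.ssubset_iff_of_subset ?_).2 ⟨(z, w), hzw, by simp⟩
        intro p hp
        simp only [hM, Finset.mem_filter, Finset.mem_product, Finset.mem_erase] at hp ⊢
        tauto
      have := Finset.card_lt_card this
      omega
  obtain ⟨x, hx⟩ : B.Nonempty := Finset.card_pos.1 h.odd_B.pos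
  have hwx : w ≠ x := by
    rintro rfl
    exact Finset.disjoint_left.1 h.disjWB hw hx
  obtain ⟨g, hg, hgc⟩ := h.rep.exists_eq s(w, x) (by simpa using hwx)
  refine h.not_isMatchable_deleteEdges hbad hw hx hg hgc ?_
  refine isMatchable_union_of_card_lt S.card S (W.erase w)
    (h.disjSW.mono_right (Finset.erase_subset _ _)) rfl
    (by rw [Finset.card_erase_of_mem hw, h.card_W]; omega) (.inl ?_)
  have hone : ((S ×ˢ W.erase w).filter fun p => s(p.1, p.2) = g).card ≤ 1 := by
    rw [Finset.card_le_one]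
    intro p hp p' hp'
    simp only [Finset.mem_filter, Finset.mem_product, Finset.mem_erase] at hp hp'
    have heq := hp.2.trans hp'.2.symm
    rw [Sym2.eq_iff] at heq
    rcases heq with h1 | h1
    · exact Prod.ext h1.1 h1.2
    · exact absurd (h1.1 ▸ hp.1.1) (Finset.disjoint_right.1 h.disjSW hp'.1.2.2)
  have hunion := Finset.card_union_le ((S ×ˢ W.erase w).filter fun p => ¬ G.Adj p.1 p.2)
    ((S ×ˢ W.erase w).filter fun p => s(p.1, p.2) = g)
  refine lt_of_le_of_lt (Finset.card_le_card (t :=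
    ((S ×ˢ W.erase w).filter fun p => ¬ G.Adj p.1 p.2) ∪
        ((S ×ˢ W.erase w).filter fun p => s(p.1, p.2) = g)) ?_) (by omega)
  intro p hp
  simp only [Finset.mem_filter, deleteEdges_adj, Set.mem_singleton_iff, Finset.mem_union] at hp ⊢
  tauto

/-- When `B` is a singleton, its vertex may be exchanged for any vertex of `W`. -/
theorem IsCriticalPartition.swap_singleton {x y : V} (h : IsCriticalPartition χ G S W {x})
    (hy : y ∈ W) : IsCriticalPartition χ G S (insert x (W.erase y)) {y} where
  rep := h.rep
  le := h.le
  disjSW := by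
    rw [Finset.disjoint_insert_right]
    exact ⟨fun hc => Finset.disjoint_left.1 h.disjSB hc (by simp),
      h.disjSW.mono_right (Finset.erase_subset _ _)⟩
  disjSB := by
    rw [Finset.disjoint_singleton_right]
    exact Finset.disjoint_right.1 h.disjSW hy
  disjWB := by
    have : y ≠ x := by
      rintro rfl
      exact Finset.disjoint_left.1 h.disjWB hy (by simp)
    simp [this]
  cover := by
    intro v
    have := h.cover v
    simp only [Finset.mem_singleton, Finset.mem_insert, Finset.mem_erase] at this ⊢
    tauto
  card_W := by
    rw [Finset.card_insert_of_notMem, Finset.card_erase_add_one hy, h.card_W]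
    intro hc
    exact Finset.disjoint_left.1 h.disjWB (Finset.mem_of_mem_erase hc) (by simp)
  odd_B := by simp
  not_adj := by
    intro w hw v hv hwv
    have hxS : x ∉ S := fun hc => Finset.disjoint_left.1 h.disjSB hc (by simp)
    rw [Finset.mem_insert] at hw
    rcases hw with rfl | hw
    · have := h.cover v
      simp only [Finset.mem_singleton] at this
      rcases this with h1 | h1 | rfl
      · exact hv h1
      · exact h.not_adj v h1 w hxS hwv.symm
      · exact hwv.ne rfl
    · exact h.not_adj w (Finset.mem_of_mem_erase hw) v hv hwv
  matchable := by
    intro v hv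
    rw [Finset.mem_singleton] at hv
    subst hv
    simpa using IsMatchable.empty

/-- The case that `B` is a singleton of `card_le_card_nonadj`, with a better bound. -/
theorem IsCriticalPartition.card_lt_card_nonadj [Fintype V] {x : V}
    (h : IsCriticalPartition χ G S W {x})
    (hbad : ∀ G, IsRepresenting χ G → ¬ IsMatchable G Finset.univ) (hS : 2 ≤ S.card) :
    S.card < ((S ×ˢ (insert x W)).filter fun p => ¬ G.Adj p.1 p.2).card := by
  have h1 := h.card_le_card_nonadj hbad hS
  obtain ⟨⟨z, y⟩, hp⟩ : ((S ×ˢ W).filter fun p => ¬ G.Adj p.1 p.2).Nonempty :=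
    Finset.card_pos.1 (by omega)
  have hp' := hp
  rw [Finset.mem_filter, Finset.mem_product] at hp'
  -- After `x` and `y` change roles, the pair `(z, y)` no longer counts, yet `|S|` nonadjacent pairs
  -- remain.
  have h2 := (h.swap_singleton hp'.1.2).card_le_card_nonadj hbad hS
  refine h2.trans_lt (Finset.card_lt_card ?_)
  refine (Finset.ssubset_iff_of_subset ?_).2 ⟨(z, y), ?_, ?_⟩
  · intro p hp
    simp only [Finset.mem_filter, Finset.mem_product, Finset.mem_insert, Finset.mem_erase] at hp ⊢
    tauto
  · simp only [Finset.mem_filter, Finset.mem_product, Finset.mem_insert]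
    exact ⟨⟨hp'.1.1, .inr hp'.1.2⟩, hp'.2⟩
  · have : y ≠ x := by
      rintro rfl
      exact Finset.disjoint_left.1 h.disjWB hp'.1.2 (by simp)
    simp [this]

end CriticalPartition

/-! ### Edge counts against barriers -/

section Counting

open scoped Classical

variable {V K : Type*}

/-- The ordered pairs in `D` that are adjacent, and those that are not. -/
theorem card_adj_add_card_nonadj (G : SimpleGraph V) (D : Finset (V × V)) :
    (D.filter fun p => G.Adj p.1 p.2).card + (D.filter fun p => ¬ G.Adj p.1 p.2).card = D.card :=
  Finset.card_filter_add_card_filter_not _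

theorem card_adj_product_comm (G : SimpleGraph V) (A B : Finset V) :
    ((A ×ˢ B).filter fun p => G.Adj p.1 p.2).card =
      ((B ×ˢ A).filter fun p => G.Adj p.1 p.2).card := by
  refine Finset.card_bij (fun p _ => p.swap) ?_ ?_ ?_
  · intro p hp
    simp only [Finset.mem_filter, Finset.mem_product, Prod.fst_swap, Prod.snd_swap] at hp ⊢
    exact ⟨hp.1.symm, hp.2.symm⟩
  · intro p _ p' _ h
    exact Prod.swap_injective h
  · intro p hp
    simp only [Finset.mem_filter, Finset.mem_product] at hp
    refine ⟨p.swap, ?_, by simp⟩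
    simp only [Finset.mem_filter, Finset.mem_product, Prod.fst_swap, Prod.snd_swap]
    exact ⟨hp.1.symm, hp.2.symm⟩

variable [Fintype V] {χ : Sym2 V → K} {G : SimpleGraph V}

/-- If every edge outside `S` lies inside a member of `P`, the edges are counted by the ordered
pairs inside `S`, between `S` and its complement, and inside the members of `P`. -/
theorem card_adj_le (S : Finset V) (P : Finset (Finset V))
    (h : ∀ u v, u ∉ S → v ∉ S → G.Adj u v → ∃ U ∈ P, u ∈ U ∧ v ∈ U) :
    ((Finset.univ : Finset (V × V)).filter fun p => G.Adj p.1 p.2).card ≤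
      (S.offDiag.filter fun p => G.Adj p.1 p.2).card +
        2 * ((S ×ˢ Sᶜ).filter fun p => G.Adj p.1 p.2).card +
        ∑ U ∈ P, (U.offDiag.filter fun p => G.Adj p.1 p.2).card := by
  have hsub : ((Finset.univ : Finset (V × V)).filter fun p => G.Adj p.1 p.2) ⊆
      (S.offDiag.filter fun p => G.Adj p.1 p.2) ∪
        (((S ×ˢ Sᶜ).filter fun p => G.Adj p.1 p.2) ∪
        ((Sᶜ ×ˢ S).filter fun p => G.Adj p.1 p.2)) ∪
        P.biUnion fun U => U.offDiag.filter fun p => G.Adj p.1 p.2 := by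
    rintro ⟨u, v⟩ hp
    simp only [Finset.mem_filter, Finset.mem_univ, true_and] at hp
    simp only [Finset.mem_union, Finset.mem_filter, Finset.mem_offDiag, Finset.mem_product,
      Finset.mem_compl, Finset.mem_biUnion, hp, and_true]
    have := hp.ne
    have := h u v
    by_cases hu : u ∈ S <;> by_cases hv : v ∈ S <;> simp_all
  have h1 := Finset.card_le_card hsub
  have h2 := card_adj_product_comm G S Sᶜ
  refine h1.trans ((Finset.card_union_le _ _).trans ?_)
  refine Nat.add_le_add ((Finset.card_union_le _ _).trans ?_) Finset.card_biUnion_le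
  refine Nat.add_le_add le_rfl ((Finset.card_union_le _ _).trans ?_)
  omega

/-- The number of edges of a graph with a barrier whose pieces cover the other vertices. -/
theorem IsBarrier.card_adj_le {S : Finset V} {P : Finset (Finset V)} (h : IsBarrier G S P)
    (hcov : ∀ v, v ∉ S → ∃ U ∈ P, v ∈ U) :
    (((Finset.univ : Finset (V × V)).filter fun p => G.Adj p.1 p.2).card : ℤ) ≤
      (S.card : ℤ) ^ 2 - S.card + 2 * S.card * (Fintype.card V - S.card) +
        ∑ U ∈ P, ((U.card : ℤ) ^ 2 - U.card) := by
  have hoff : ∀ U : Finset V, ((U.offDiag.filter fun p => G.Adj p.1 p.2).card : ℤ) ≤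
      (U.card : ℤ) ^ 2 - U.card := by
    intro U
    have h1 := Finset.card_filter_le U.offDiag fun p => G.Adj p.1 p.2
    rw [Finset.offDiag_card] at h1
    have h2 : U.card ≤ U.card * U.card := Nat.le_mul_self _
    zify [h2] at h1
    linarith [h1]
  have h1 := _root_.card_adj_le (G := G) S P (by
    intro u v hu hv huv
    obtain ⟨U, hU, huU⟩ := hcov u hu
    refine ⟨U, hU, huU, ?_⟩
    by_contra hvU
    exact h.not_adj U hU u huU v hvU hv huv)
  have h2 : (((S ×ˢ Sᶜ).filter fun p => G.Adj p.1 p.2).card : ℤ) ≤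
      S.card * (Fintype.card V - S.card) := by
    have h3 := Finset.card_filter_le (S ×ˢ Sᶜ) fun p => G.Adj p.1 p.2
    rw [Finset.card_product, Finset.card_compl] at h3
    zify [Finset.card_le_univ S] at h3
    exact h3
  have h3 : (∑ U ∈ P, ((U.offDiag.filter fun p => G.Adj p.1 p.2).card : ℤ)) ≤
      ∑ U ∈ P, ((U.card : ℤ) ^ 2 - U.card) := Finset.sum_le_sum fun U _ => hoff U
  have h4 := hoff S
  zify at h1
  linarith

theorem IsBarrier.sum_card {S : Finset V} {P : Finset (Finset V)} (h : IsBarrier G S P)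
    (hcov : ∀ v, v ∉ S → ∃ U ∈ P, v ∈ U) : ∑ U ∈ P, U.card + S.card = Fintype.card V := by
  have h1 : P.biUnion id = Sᶜ := by
    ext v
    simp only [Finset.mem_biUnion, id, Finset.mem_compl]
    exact ⟨fun ⟨U, hU, hv⟩ => Finset.disjoint_left.1 (h.disj U hU) hv, hcov v⟩
  have h2 := Finset.card_biUnion (s := P) (t := id) fun U hU U' hU' hne => h.pairwise hU hU' hne
  rw [h1, Finset.card_compl] at h2
  have := Finset.card_le_univ S
  simp only [id] at h2
  omega

variable {s : ℕ} {S : Finset V} {P : Finset (Finset V)}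

/-- With many colors, the deficiency of a barrier of a representing graph is exactly `2`. -/
theorem IsBarrier.card_eq (h : IsBarrier G S P) (hrep : IsRepresenting χ G)
    (hcov : ∀ v, v ∉ S → ∃ U ∈ P, v ∈ U) (hV : Fintype.card V = 2 * s)
    (h1 : 4 * (s : ℤ) ^ 2 - 14 * s + 18 ≤ 2 * (χ '' {e | ¬ e.IsDiag}).ncard)
    (h2 : 3 * (s : ℤ) ^ 2 - 5 * s + 2 ≤ 2 * (χ '' {e | ¬ e.IsDiag}).ncard) :
    P.card = S.card + 2 := by
  have hle := h.card_le
  have hsum := h.sum_card hcov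
  have hcnt := h.card_adj_le hcov
  rw [hrep.card_adj] at hcnt
  -- All pieces are odd, so `|P|` and `|S|` have the same parity, and an excess other than 2 is at
  -- least 4.
  have hpar : Even (∑ U ∈ P, (U.card + 1)) := by
    refine Finset.even_sum _ fun U hU => (h.odd U hU).add_one
  rw [Finset.sum_add_distrib, Finset.sum_const, smul_eq_mul, mul_one, Nat.even_iff] at hpar
  by_contra hne
  have hP : S.card + 4 ≤ P.card := by omega
  have ha : ∀ U ∈ P, (0 : ℤ) ≤ (U.card : ℤ) - 1 := by
    intro U hU
    have := (h.odd U hU).pos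
    omega
  have hsq := Finset.sum_sq_le_sq_sum_of_nonneg ha
  have hsum' : ∑ U ∈ P, ((U.card : ℤ) - 1) = 2 * s - S.card - P.card := by
    rw [Finset.sum_sub_distrib, Finset.sum_const, nsmul_eq_mul, mul_one]
    have : ((∑ U ∈ P, U.card : ℕ) : ℤ) + S.card = 2 * s := by
      exact_mod_cast hsum.trans hV
    push_cast at this
    linarith
  have hnn := Finset.sum_nonneg ha
  have hexp : ∑ U ∈ P, ((U.card : ℤ) ^ 2 - U.card) =
      ∑ U ∈ P, ((U.card : ℤ) - 1) ^ 2 + ∑ U ∈ P, ((U.card : ℤ) - 1) := by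
    rw [← Finset.sum_add_distrib]
    exact Finset.sum_congr rfl fun U _ => by ring
  rw [hsum'] at hsq hnn hexp
  rw [hexp, hV] at hcnt
  push_cast at hcnt
  have hPz : (S.card : ℤ) + 4 ≤ P.card := by exact_mod_cast hP
  set q : ℤ := (S.card : ℤ)
  have hq : 0 ≤ q := by positivity
  set A : ℤ := 2 * s - q - P.card
  have hA : A ≤ 2 * s - 2 * q - 4 := by linarith
  have hA2 : A ^ 2 ≤ (2 * s - 2 * q - 4) ^ 2 := pow_le_pow_left₀ hnn hA 2
  -- The count is largest when one piece takes all surplus vertices. The bound is convex in `q`,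
  -- with `0 ≤ q ≤ s - 2`; it contradicts `h1` at `q = 0` and `h2` at `q = s - 2`.
  have hF : 2 * ((χ '' {e | ¬ e.IsDiag}).ncard : ℤ) ≤
      q * (3 * q + 13 - 4 * s) + 4 * s ^ 2 - 14 * s + 12 := by nlinarith
  rcases le_or_gt (3 * q + 13 - 4 * s) 0 with hneg | hpos
  · nlinarith [mul_nonneg hq (neg_nonneg.2 hneg)]
  · have h5 : 0 ≤ (s : ℤ) - 2 - q := by linarith
    have h6 : 0 ≤ 3 * q - s + 7 := by linarith
    nlinarith [mul_nonneg h5 h6]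

/-- With many colors, a nonempty barrier of a representing graph has at most one piece with more
than one vertex. -/
theorem IsBarrier.exists_card_eq_one (h : IsBarrier G S P) (hrep : IsRepresenting χ G)
    (hcov : ∀ v, v ∉ S → ∃ U ∈ P, v ∈ U) (hV : Fintype.card V = 2 * s) (hS : S.Nonempty)
    (h1 : 4 * (s : ℤ) ^ 2 - 14 * s + 18 ≤ 2 * (χ '' {e | ¬ e.IsDiag}).ncard)
    (h2 : 3 * (s : ℤ) ^ 2 - 5 * s + 2 ≤ 2 * (χ '' {e | ¬ e.IsDiag}).ncard) :
    ∃ B ∈ P, ∀ U ∈ P, U ≠ B → U.card = 1 := by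
  have hPc := h.card_eq hrep hcov hV h1 h2
  obtain ⟨B, hB, hmax⟩ := P.exists_max_image Finset.card (Finset.card_pos.1 (by omega))
  refine ⟨B, hB, fun U hU hUB => ?_⟩
  by_contra hne
  have hU3 : 3 ≤ U.card := by
    rcases h.odd U hU with ⟨m, hm⟩
    omega
  have hB3 := hmax U hU
  have hsum := h.sum_card hcov
  have hcnt := h.card_adj_le hcov
  rw [hrep.card_adj] at hcnt
  have ha : ∀ U ∈ P, (0 : ℤ) ≤ (U.card : ℤ) - 1 := by
    intro U hU
    have := (h.odd U hU).pos
    omega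
  have ha' : ∀ X ∈ P.erase U, (0 : ℤ) ≤ (X.card : ℤ) - 1 := fun X hX =>
    ha X (Finset.mem_of_mem_erase hX)
  have hsq := Finset.sum_sq_le_sq_sum_of_nonneg ha'
  have hBle : (B.card : ℤ) - 1 ≤ ∑ X ∈ P.erase U, ((X.card : ℤ) - 1) :=
    Finset.single_le_sum (f := fun X : Finset V => (X.card : ℤ) - 1) ha'
      (Finset.mem_erase.2 ⟨hUB.symm, hB⟩)
  have hsum' : ∑ U ∈ P, ((U.card : ℤ) - 1) = 2 * s - 2 * S.card - 2 := by
    rw [Finset.sum_sub_distrib, Finset.sum_const, nsmul_eq_mul, mul_one, hPc]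
    have : ((∑ U ∈ P, U.card : ℕ) : ℤ) + S.card = 2 * s := by
      exact_mod_cast hsum.trans hV
    push_cast at this ⊢
    linarith
  rw [← Finset.add_sum_erase P _ hU] at hsum'
  have hexp : ∑ U ∈ P, ((U.card : ℤ) ^ 2 - U.card) = ((U.card : ℤ) - 1) ^ 2 +
      ∑ U ∈ P.erase U, ((U.card : ℤ) - 1) ^ 2 + (((U.card : ℤ) - 1) +
        ∑ U ∈ P.erase U, ((U.card : ℤ) - 1)) := by
    rw [Finset.add_sum_erase P (fun U => ((U.card : ℤ) - 1)) hU,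
      Finset.add_sum_erase P (fun U => ((U.card : ℤ) - 1) ^ 2) hU, ← Finset.sum_add_distrib]
    exact Finset.sum_congr rfl fun U _ => by ring
  rw [hexp, hV] at hcnt
  push_cast at hcnt
  have hq : (1 : ℤ) ≤ S.card := by exact_mod_cast Finset.card_pos.2 hS
  set q : ℤ := (S.card : ℤ)
  set a : ℤ := (U.card : ℤ) - 1
  have ha2 : 2 ≤ a := by
    have : (3 : ℤ) ≤ U.card := by exact_mod_cast hU3
    linarith
  have hab : a ≤ (B.card : ℤ) - 1 := by
    have : (U.card : ℤ) ≤ B.card := by exact_mod_cast hB3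
    linarith
  set b : ℤ := ∑ X ∈ P.erase U, ((X.card : ℤ) - 1)
  -- Here `b` lumps together all pieces other than `U`. For fixed `a + b` with `a, b ≥ 2`, the sum
  -- of squares is largest when one of the two is 2.
  have hprod : 0 ≤ (a - 2) * (b - 2) := mul_nonneg (by linarith) (by linarith)
  have hab2 : a ^ 2 + b ^ 2 ≤ (a + b) ^ 2 - 4 * (a + b) + 8 := by linarith
  rw [hsum'] at hab2
  -- At `q = 0` this is only equality in `h1`, hence the need for a nonempty `S`. At the other end,
  -- `q = s - 3`, it contradicts `h2`.
  have hF : 2 * ((χ '' {e | ¬ e.IsDiag}).ncard : ℤ) ≤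
      q * (3 * q + 13 - 4 * s) + 4 * s ^ 2 - 14 * s + 18 := by linarith
  rcases lt_or_ge (3 * q + 13 - 4 * s) 0 with hneg | hpos
  · nlinarith [mul_pos (by linarith : 0 < q) (neg_pos.2 hneg)]
  · have h5 : 0 ≤ (s : ℤ) - 3 - q := by linarith
    have h6 : 0 ≤ 3 * q - s + 4 := by linarith
    nlinarith [mul_nonneg h5 h6]

/-- A maximum barrier of a coloring with many colors is nonempty. -/
theorem IsMaxBarrier.nonempty (h : IsMaxBarrier χ G S P)
    (hbad : ∀ G, IsRepresenting χ G → ¬ IsMatchable G Finset.univ)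
    (hcov : ∀ v, v ∉ S → ∃ U ∈ P, v ∈ U) (hV : Fintype.card V = 2 * s)
    (h1 : 4 * (s : ℤ) ^ 2 - 14 * s + 18 ≤ 2 * (χ '' {e | ¬ e.IsDiag}).ncard)
    (h2 : 3 * (s : ℤ) ^ 2 - 5 * s + 2 ≤ 2 * (χ '' {e | ¬ e.IsDiag}).ncard) :
    S.Nonempty := by
  rw [Finset.nonempty_iff_ne_empty]
  rintro rfl
  have hPc := h.card_eq h.rep hcov hV h1 h2
  rw [Finset.card_empty, Finset.card_eq_two] at hPc
  obtain ⟨A, B, hAB, rfl⟩ := hPc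
  have hA : A ∈ ({A, B} : Finset (Finset V)) := by simp
  have hB : B ∈ ({A, B} : Finset (Finset V)) := by simp
  obtain ⟨a, ha⟩ := Finset.card_pos.1 (h.odd A hA).pos
  obtain ⟨b, hb⟩ := Finset.card_pos.1 (h.odd B hB).pos
  have hd : Disjoint A B := h.pairwise hA hB hAB
  have hab : a ≠ b := by
    rintro rfl
    exact Finset.disjoint_left.1 hd ha hb
  obtain ⟨g, hg, hgc⟩ := h.rep.exists_eq s(a, b) (by simpa using hab)
  have hrep := h.rep.exchange (e := s(a, b)) (by simpa using hab) hg hgc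
  -- By maximality this barrier is empty too, so some odd `U` is closed under adjacency. But `A` and
  -- `B` each stay in one piece without `g` and are now joined by `ab`, so `U` would be empty or the
  -- whole, even, vertex set.
  obtain ⟨T, P', hT⟩ := exists_isBarrier (G := exchange G s(a, b) g) (by rw [hV]; simp)
    (hbad _ hrep)
  have hT0 := h.le _ _ _ hrep hT
  rw [Finset.card_empty, Nat.le_zero, Finset.card_eq_zero] at hT0
  subst hT0
  obtain ⟨U, hU⟩ : P'.Nonempty := Finset.card_pos.1 (by have := hT.card_le; omega)
  have hUodd := hT.odd U hU
  have hclosed : ∀ u ∈ U, ∀ v, v ∉ U → ¬ (exchange G s(a, b) g).Adj u v :=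
    fun u hu v hv => hT.not_adj U hU u hu v hv (by simp)
  have habU : a ∈ U ↔ b ∈ U := by
    have hadj : (exchange G s(a, b) g).Adj a b := exchange_adj_new hab
    constructor
    · intro haU
      by_contra hbU
      exact hclosed a haU b hbU hadj
    · intro hbU
      by_contra haU
      exact hclosed b hbU a haU hadj.symm
  have key : ∀ C ∈ ({A, B} : Finset (Finset V)), U ∩ C = ∅ ∨ U ∩ C = C := by
    intro C hC
    refine eq_empty_or_eq_of_factorCritical (h.odd C hC)
      (fun v hv => h.isMatchable_erase hC hv) g
      Finset.inter_subset_right ?_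
    intro u hu v hv hvU huv
    rw [Finset.mem_inter] at hu hvU
    by_contra hne
    exact hclosed u hu.1 v (fun hc => hvU ⟨hc, hv⟩) (exchange_adj_old huv hne)
  have hcov' : ∀ v, v ∈ A ∨ v ∈ B := by
    intro v
    obtain ⟨C, hC, hv⟩ := hcov v (by simp)
    rw [Finset.mem_insert, Finset.mem_singleton] at hC
    rcases hC with rfl | rfl
    · exact .inl hv
    · exact .inr hv
  have hUc : U.card = (U ∩ A).card + (U ∩ B).card := by
    rw [← Finset.card_union_of_disjoint
      (hd.mono Finset.inter_subset_right Finset.inter_subset_right), ← Finset.inter_union_distrib_left]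
    congr 1
    ext v
    simp [hcov' v]
  have hAo := h.odd A hA
  have hBo := h.odd B hB
  have haA : U ∩ A = A → a ∈ U := fun hc => by
    have : a ∈ U ∩ A := by rwa [hc]
    exact (Finset.mem_inter.1 this).1
  have hbB : U ∩ B = B → b ∈ U := fun hc => by
    have : b ∈ U ∩ B := by rwa [hc]
    exact (Finset.mem_inter.1 this).1
  have haA' : U ∩ A = ∅ → a ∉ U := fun hc hc' => by
    have : a ∈ U ∩ A := Finset.mem_inter.2 ⟨hc', ha⟩
    simp [hc] at this
  have hbB' : U ∩ B = ∅ → b ∉ U := fun hc hc' => by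
    have : b ∈ U ∩ B := Finset.mem_inter.2 ⟨hc', hb⟩
    simp [hc] at this
  rw [Nat.odd_iff] at hUodd hAo hBo
  rcases key A hA with hA' | hA' <;> rcases key B hB with hB' | hB'
  · rw [hA', hB'] at hUc
    simp at hUc
    simp [hUc] at hUodd
  · exact haA' hA' (habU.2 (hbB hB'))
  · exact hbB' hB' (habU.1 (haA hA'))
  · rw [hA', hB'] at hUc
    omega

/-- With many colors and no rainbow perfect matching there is a critical partition. -/
theorem exists_isCriticalPartition
    (hbad : ∀ G, IsRepresenting χ G → ¬ IsMatchable G Finset.univ)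
    (hV : Fintype.card V = 2 * s)
    (h1 : 4 * (s : ℤ) ^ 2 - 14 * s + 18 ≤ 2 * (χ '' {e | ¬ e.IsDiag}).ncard)
    (h2 : 3 * (s : ℤ) ^ 2 - 5 * s + 2 ≤ 2 * (χ '' {e | ¬ e.IsDiag}).ncard) :
    ∃ G S W B, IsCriticalPartition χ G S W B ∧ S.Nonempty := by
  obtain ⟨G, S, P₀, hP₀⟩ := exists_isMaxBarrier (by rw [hV]; simp) hbad
  obtain ⟨P, h, hcov⟩ := hP₀.exists_cover
  have hS := h.nonempty hbad hcov hV h1 h2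
  have hPc := h.card_eq h.rep hcov hV h1 h2
  have hsum := h.sum_card hcov
  obtain ⟨B, hB, hone⟩ := h.exists_card_eq_one h.rep hcov hV hS h1 h2
  have hWU : ∀ w, w ∉ S → w ∉ B → {w} ∈ P := by
    intro w hw hwB
    obtain ⟨U, hU, hwU⟩ := hcov w hw
    obtain ⟨u, rfl⟩ := Finset.card_eq_one.1 (hone U hU (by rintro rfl; exact hwB hwU))
    rw [Finset.mem_singleton] at hwU
    rwa [hwU]
  have hBS := h.disj B hB
  refine ⟨G, S, (S ∪ B)ᶜ, B, ⟨h.rep, h.le, ?_, hBS.symm, ?_, ?_, ?_, h.odd B hB, ?_, ?_⟩, hS⟩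
  · rw [Finset.disjoint_left]
    intro v hv hv'
    rw [Finset.mem_compl] at hv'
    exact hv' (Finset.mem_union_left _ hv)
  · rw [Finset.disjoint_left]
    intro v hv hvB
    rw [Finset.mem_compl] at hv
    exact hv (Finset.mem_union_right _ hvB)
  · intro v
    simp only [Finset.mem_compl, Finset.mem_union]
    tauto
  · rw [← Finset.add_sum_erase P _ hB, Finset.sum_congr rfl (fun U hU =>
      hone U (Finset.mem_of_mem_erase hU) (Finset.ne_of_mem_erase hU)), Finset.sum_const,
      Finset.card_erase_of_mem hB, hPc] at hsum
    rw [Finset.card_compl, Finset.card_union_of_disjoint hBS.symm]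
    simp only [smul_eq_mul] at hsum
    omega
  · intro w hw v hv hwv
    rw [Finset.mem_compl, Finset.mem_union, not_or] at hw
    refine h.not_adj {w} (hWU w hw.1 hw.2) w (by simp) v ?_ hv hwv
    simpa using hwv.ne.symm
  · exact fun v hv => h.isMatchable_erase hB hv

end Counting

/-! ### Rainbow perfect matchings in colorings with many colors -/

section Upper

open scoped Classical

variable {V K : Type*} {χ : Sym2 V → K} {G : SimpleGraph V}

/-- Between disjoint sets, an edge occurs as at most one ordered pair. -/
theorem card_filter_eq_le_one {A B : Finset V} (hd : Disjoint A B) (g : Sym2 V) :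
    ((A ×ˢ B).filter fun p => s(p.1, p.2) = g).card ≤ 1 := by
  rw [Finset.card_le_one]
  intro p hp p' hp'
  simp only [Finset.mem_filter, Finset.mem_product] at hp hp'
  have heq := hp.2.trans hp'.2.symm
  rw [Sym2.eq_iff] at heq
  rcases heq with h1 | h1
  · exact Prod.ext h1.1 h1.2
  · exact absurd (h1.1 ▸ hp.1.1) (Finset.disjoint_right.1 hd hp'.1.2)

/-- A set of `2 p` vertices with fewer than `p - 1` nonadjacent ordered pairs remains matchable
when an edge is deleted. -/
theorem isMatchable_deleteEdges_of_card_lt {p : ℕ} {X : Finset V} (hX : X.card = 2 * p)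
    (h : (X.offDiag.filter fun p => ¬ G.Adj p.1 p.2).card + 1 < p) (g : Sym2 V) :
    IsMatchable (G.deleteEdges {g}) X := by
  refine isMatchable_of_card_lt p X hX fun A hA B hB hd => .inl ?_
  have h1 := card_filter_eq_le_one hd g
  have h2 := Finset.card_union_le (X.offDiag.filter fun p => ¬ G.Adj p.1 p.2)
    ((A ×ˢ B).filter fun p => s(p.1, p.2) = g)
  refine lt_of_le_of_lt (Finset.card_le_card (t := (X.offDiag.filter fun p => ¬ G.Adj p.1 p.2) ∪
    ((A ×ˢ B).filter fun p => s(p.1, p.2) = g)) ?_) (by omega)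
  intro p hp
  simp only [Finset.mem_filter, Finset.mem_product, deleteEdges_adj, Set.mem_singleton_iff,
    Finset.mem_union, Finset.mem_offDiag] at hp ⊢
  have : p.1 ≠ p.2 := fun hc => Finset.disjoint_left.1 hd hp.1.1 (hc ▸ hp.1.2)
  have := hA hp.1.1
  have := hB hp.1.2
  tauto

theorem isMatchable_of_clique {X : Finset V} (hX : Even X.card)
    (h : ∀ a ∈ X, ∀ b ∈ X, a ≠ b → G.Adj a b) : IsMatchable G X := by
  obtain ⟨p, hp⟩ := hX
  refine isMatchable_of_card_lt p X (by omega) fun A hA B hB hd => ?_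
  have : ((A ×ˢ B).filter fun p => ¬ G.Adj p.1 p.2) = ∅ := by
    rw [Finset.filter_eq_empty_iff]
    intro p hp
    rw [Finset.mem_product] at hp
    rw [not_not]
    exact h _ (hA hp.1) _ (hB hp.2) fun hc => Finset.disjoint_left.1 hd hp.1 (hc ▸ hp.2)
  rw [this, Finset.card_empty]
  omega

/-- A triangle and a clique on the other vertices cannot form a rainbow graph. -/
theorem false_of_triangle_and_clique [Fintype V] {s : ℕ} (hs : 4 ≤ s)
    (hV : Fintype.card V = 2 * s)
    (hbad : ∀ G, IsRepresenting χ G → ¬ IsMatchable G Finset.univ)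
    (hrep : IsRepresenting χ G) {w₁ w₂ w₃ : V} (h₁₂ : G.Adj w₁ w₂) (h₁₃ : G.Adj w₁ w₃)
    (h₂₃ : G.Adj w₂ w₃) {Y : Finset V} (hY : ∀ v, v ∈ Y ↔ v ≠ w₁ ∧ v ≠ w₂ ∧ v ≠ w₃)
    (hclique : ∀ a ∈ Y, ∀ b ∈ Y, a ≠ b → G.Adj a b) : False := by
  have hYc : Y.card = 2 * s - 3 := by
    have : Y = ({w₁, w₂, w₃} : Finset V)ᶜ := by
      ext v
      simp [hY]
    rw [this, Finset.card_compl, Finset.card_eq_three.2 ⟨w₁, w₂, w₃, h₁₂.ne, h₁₃.ne, h₂₃.ne, rfl⟩,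
      hV]
  -- Otherwise the exchange that brings in `ub` spares `vw`, and `Y \ {b}` remains matchable without
  -- `g`.
  have key : ∀ u v w b, G.Adj v w → u ≠ v → u ≠ w → b ∈ Y →
      (∀ x, x ∈ Y ↔ x ≠ u ∧ x ≠ v ∧ x ≠ w) → χ s(v, w) = χ s(u, b) := by
    intro u v w b hvw huv huw hb hY'
    have hbY := (hY' b).1 hb
    obtain ⟨g, hg, hgc⟩ := hrep.exists_eq s(u, b) (by simpa using hbY.1.symm)
    by_contra hne
    have hgne : s(v, w) ≠ g := by
      rintro rfl
      exact hne hgc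
    have hrep' := hrep.exchange (e := s(u, b)) (by simpa using hbY.1.symm) hg hgc
    refine hbad _ hrep' ?_
    have hrest : IsMatchable (exchange G s(u, b) g) (Y.erase b) := by
      refine (isMatchable_deleteEdges_of_card_lt (p := s - 2) ?_ ?_ g).mono
        (deleteEdges_le_exchange G s(u, b) g)
      · rw [Finset.card_erase_of_mem hb]
        omega
      · have : ((Y.erase b).offDiag.filter fun p => ¬ G.Adj p.1 p.2) = ∅ := by
          rw [Finset.filter_eq_empty_iff]
          intro p hp
          simp only [Finset.mem_offDiag, Finset.mem_erase] at hp
          rw [not_not]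
          exact hclique _ hp.1.2 _ hp.2.1.2 hp.2.2
        rw [this, Finset.card_empty]
        omega
    have h1 : IsMatchable (exchange G s(u, b) g) (insert v (insert w (Y.erase b))) := by
      refine .insert_pair (exchange_adj_old hvw hgne) ?_ ?_ hrest <;> simp [hY']
    have h2 : IsMatchable (exchange G s(u, b) g)
        (insert u (insert b (insert v (insert w (Y.erase b))))) := by
      refine .insert_pair (exchange_adj_new hbY.1.symm) ?_ ?_ h1 <;> simp [hY', hbY, huv, huw]
    convert h2 using 1
    ext x
    simp only [Finset.mem_univ, Finset.mem_insert, Finset.mem_erase, hY', true_iff]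
    tauto
  -- By `key` the three triangle edges can be exchanged for disjoint edges from the triangle to `Y`;
  -- an even clique is left over.
  obtain ⟨X, hX, hXc⟩ := Finset.exists_subset_card_eq (s := Y) (n := 3) (by omega)
  obtain ⟨b₁, b₂, b₃, hb₁₂, hb₁₃, hb₂₃, rfl⟩ := Finset.card_eq_three.1 hXc
  have hb₁ : b₁ ∈ Y := hX (by simp)
  have hb₂ : b₂ ∈ Y := hX (by simp)
  have hb₃ : b₃ ∈ Y := hX (by simp)
  have hc₁ := key w₁ w₂ w₃ b₁ h₂₃ h₁₂.ne h₁₃.ne hb₁ hY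
  have hc₂ := key w₂ w₁ w₃ b₂ h₁₃ h₁₂.ne.symm h₂₃.ne hb₂ (by intro x; rw [hY]; tauto)
  have hc₃ := key w₃ w₁ w₂ b₃ h₁₂ h₁₃.ne.symm h₂₃.ne.symm hb₃ (by intro x; rw [hY]; tauto)
  have n₁ := (hY b₁).1 hb₁
  have n₂ := (hY b₂).1 hb₂
  have n₃ := (hY b₃).1 hb₃
  have d₁₂ := h₁₂.ne
  have d₁₃ := h₁₃.ne
  have d₂₃ := h₂₃.ne
  have hr₁ := hrep.exchange (e := s(w₁, b₁)) (by simpa using n₁.1.symm) h₂₃ hc₁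
  have hr₂ := hr₁.exchange (e := s(w₂, b₂)) (g := s(w₁, w₃)) (by simpa using n₂.2.1.symm)
    (exchange_adj_old h₁₃ (by simp [d₁₂, d₁₃])) hc₂
  have hr₃ := hr₂.exchange (e := s(w₃, b₃)) (g := s(w₁, w₂)) (by simpa using n₃.2.2.symm)
    (exchange_adj_old (exchange_adj_old h₁₂ (by simp [d₁₂, d₁₃])) (by simp [d₂₃, d₁₂.symm])) hc₃
  refine hbad _ hr₃ ?_
  have hrest : IsMatchable G (Y \ {b₁, b₂, b₃}) := by
    refine isMatchable_of_clique ?_ ?_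
    · rw [Finset.card_sdiff_of_subset hX, hYc, hXc]
      exact ⟨s - 3, by omega⟩
    · intro a ha b hb hab
      exact hclique a (Finset.mem_sdiff.1 ha).1 b (Finset.mem_sdiff.1 hb).1 hab
  have h0 := hrest.mono_on (G' := exchange (exchange (exchange G s(w₁, b₁) s(w₂, w₃))
      s(w₂, b₂) s(w₁, w₃)) s(w₃, b₃) s(w₁, w₂)) (by
    intro a ha b hb hab
    simp only [Finset.mem_sdiff, hY] at ha hb
    refine exchange_adj_old (exchange_adj_old (exchange_adj_old hab ?_) ?_) ?_ <;>
      simp [ha.1])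
  have h1 := IsMatchable.insert_pair (a := w₁) (b := b₁) (by
    refine exchange_adj_old (exchange_adj_old (exchange_adj_new n₁.1.symm) ?_) ?_ <;>
      simp [n₁, d₁₂, d₁₃]) (by simp [hY]) (by simp) h0
  have h2 := IsMatchable.insert_pair (a := w₂) (b := b₂) (by
    refine exchange_adj_old (exchange_adj_new n₂.2.1.symm) ?_
    simp [n₂, d₁₂.symm]) (by simp [hY, d₁₂.symm, n₁.2.1.symm]) (by simp [n₂, hb₁₂.symm]) h1
  have h3 := IsMatchable.insert_pair (a := w₃) (b := b₃) (by
    exact exchange_adj_new n₃.2.2.symm) (by simp [hY, d₁₃.symm, d₂₃.symm, n₁.2.2.symm, n₂.2.2.symm])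
    (by simp [n₃, hb₁₃.symm, hb₂₃.symm]) h2
  convert h3 using 1
  ext x
  simp only [Finset.mem_univ, Finset.mem_insert, Finset.mem_sdiff, Finset.mem_singleton, hY,
    true_iff]
  tauto

namespace IsCriticalPartition

variable {S W B : Finset V}

theorem compl_eq [Fintype V] (h : IsCriticalPartition χ G S W B) : Sᶜ = W ∪ B := by
  ext v
  simp only [Finset.mem_compl, Finset.mem_union]
  have := h.cover v
  have h1 : v ∈ S → v ∉ W := fun hv => Finset.disjoint_left.1 h.disjSW hv
  have h2 : v ∈ S → v ∉ B := fun hv => Finset.disjoint_left.1 h.disjSB hv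
  tauto

theorem card_B [Fintype V] (h : IsCriticalPartition χ G S W B) {s : ℕ}
    (hV : Fintype.card V = 2 * s) : B.card + 2 * S.card + 1 = 2 * s := by
  have h1 := congrArg Finset.card h.compl_eq
  rw [Finset.card_compl, Finset.card_union_of_disjoint h.disjWB, h.card_W] at h1
  have := Finset.card_le_univ S
  omega

/-- The number of colors, in terms of the nonadjacent pairs. -/
theorem card_nonadj_le [Fintype V] (h : IsCriticalPartition χ G S W B) {s : ℕ}
    (hV : Fintype.card V = 2 * s) :
    2 * ((χ '' {e | ¬ e.IsDiag}).ncard : ℤ) + (S.offDiag.filter fun p => ¬ G.Adj p.1 p.2).card +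
      2 * ((S ×ˢ W).filter fun p => ¬ G.Adj p.1 p.2).card +
      2 * ((S ×ˢ B).filter fun p => ¬ G.Adj p.1 p.2).card +
      (B.offDiag.filter fun p => ¬ G.Adj p.1 p.2).card ≤
      3 * S.card ^ 2 + S.card * (5 - 4 * s) + 4 * s ^ 2 - 6 * s + 2 := by
  have h1 := card_adj_le (G := G) S {B} (by
    intro u v hu hv huv
    refine ⟨B, by simp, ?_, ?_⟩
    · rcases h.cover u with h1 | h1 | h1
      · exact absurd h1 hu
      · exact absurd huv (h.not_adj u h1 v hv)
      · exact h1
    · rcases h.cover v with h1 | h1 | h1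
      · exact absurd h1 hv
      · exact absurd huv.symm (h.not_adj v h1 u hu)
      · exact h1)
  rw [h.rep.card_adj, Finset.sum_singleton] at h1
  have h2 := card_adj_add_card_nonadj G S.offDiag
  have h3 := card_adj_add_card_nonadj G B.offDiag
  have h4 := card_adj_add_card_nonadj G (S ×ˢ W)
  have h5 := card_adj_add_card_nonadj G (S ×ˢ B)
  have h6 : ((S ×ˢ Sᶜ).filter fun p => G.Adj p.1 p.2).card =
      ((S ×ˢ W).filter fun p => G.Adj p.1 p.2).card +
      ((S ×ˢ B).filter fun p => G.Adj p.1 p.2).card := by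
    rw [h.compl_eq, Finset.product_union, Finset.filter_union, Finset.card_union_of_disjoint]
    refine Finset.disjoint_filter_filter ?_
    rw [Finset.disjoint_product]
    exact .inr h.disjWB
  have h7 := h.card_B hV
  have h8 := h.card_W
  rw [Finset.offDiag_card] at h2 h3
  rw [Finset.card_product] at h4 h5
  have h9 : S.card ≤ S.card * S.card := Nat.le_mul_self _
  have h10 : B.card ≤ B.card * B.card := Nat.le_mul_self _
  zify [h9, h10] at h1 h2 h3 h4 h5 h6 h7 h8
  have h11 : (B.card : ℤ) = 2 * s - 2 * S.card - 1 := by linarith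
  rw [h8] at h4
  rw [h11] at h3 h5
  nlinarith

/-- The case of a single vertex `z` in `S` that is not adjacent to all of `W`. -/
theorem false_of_singleton_of_not_adj [Fintype V] {z w₁ w₂ y₁ y₂ : V}
    (h : IsCriticalPartition χ G {z} W B)
    (hbad : ∀ G, IsRepresenting χ G → ¬ IsMatchable G Finset.univ)
    (hW : W = {w₁, w₂}) (hne : w₁ ≠ w₂) (hzw : ¬ G.Adj z w₂) (hy₁ : y₁ ∈ B) (hy₂ : y₂ ∈ B)
    (hy : y₁ ≠ y₂) (hzy₁ : G.Adj z y₁) (hzy₂ : G.Adj z y₂) : False := by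
  have hw₁ : w₁ ∈ W := by simp [hW]
  have hw₂ : w₂ ∈ W := by simp [hW]
  have hzB : z ∉ B := by simpa using h.disjSB
  have hzW : z ∉ W := by simpa using h.disjSW
  have hw₁B : w₁ ∉ B := Finset.disjoint_left.1 h.disjWB hw₁
  have hw₂B : w₂ ∉ B := Finset.disjoint_left.1 h.disjWB hw₂
  have hzw₁ : w₁ ≠ z := by rintro rfl; exact hzW hw₁
  have hzw₂ : w₂ ≠ z := by rintro rfl; exact hzW hw₂
  have hcov : ∀ v, v = w₁ ∨ v = w₂ ∨ v = z ∨ v ∈ B := by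
    intro v
    have := h.cover v
    simp only [hW, Finset.mem_singleton, Finset.mem_insert] at this
    tauto
  obtain ⟨g, hg, hgc⟩ := h.rep.exists_eq s(w₁, w₂) (by simpa using hne)
  set G' := exchange G s(w₁, w₂) g with hG'
  have hrep : IsRepresenting χ G' := h.rep.exchange (by simpa using hne) hg hgc
  have hF : ¬ IsMatchable G' (insert z B) := by
    intro hF
    refine hbad G' hrep ?_
    convert IsMatchable.insert_pair (exchange_adj_new hne) (by simp [hzw₁, hw₁B])
      (by simp [hzw₂, hw₂B]) hF using 1
    ext v
    simpa using hcov v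
  have hev : Even (insert z B).card := by
    rw [Finset.card_insert_of_notMem hzB]
    exact h.odd_B.add_one
  obtain ⟨T, P', hT, hcard, hP', hd⟩ := exists_odd_pieces hev hF
  -- The vertex `w₂` is isolated in `G`, so `w₁` is its only neighbour in `G'`. Hence `{w₂}` is a
  -- piece of the barrier `{w₁} ∪ T`, and maximality forces `T = ∅`.
  have hnadj : ∀ v, v ≠ w₁ → ¬ G'.Adj w₂ v := by
    intro v hv hadj
    rw [hG', exchange_adj] at hadj
    rcases hadj.2 with h1 | h1
    · rw [Sym2.eq_iff] at h1
      rcases h1 with h1 | h1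
      · exact hne h1.1.symm
      · exact hv h1.2
    · refine h.not_adj w₂ hw₂ v ?_ h1.1
      rw [Finset.mem_singleton]
      rintro rfl
      exact hzw h1.1.symm
  have hb := IsBarrier.refine (G := G') (S := {w₁}) (T := T) (C := insert z B)
    (P₁ := {{w₂}}) (P' := P') (by simp) (by simpa using hne)
    (by simp [hzw₂.symm, hw₂B])
    (by
      intro U hU u hu v _ hv
      rw [Finset.mem_singleton] at hU
      subst hU
      rw [Finset.mem_singleton] at hu hv
      subst hu
      exact hnadj v hv)
    (by simp) (by simp [hzw₁, hw₁B]) hT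
    (by
      intro u hu v hv hvw hadj
      rw [Finset.mem_insert, not_or] at hv
      rw [Finset.mem_singleton] at hvw
      have hv₂ : v = w₂ := by
        have := hcov v
        tauto
      subst hv₂
      refine hnadj u ?_ hadj.symm
      rintro rfl
      simp [hzw₁, hw₁B] at hu)
    hP' hd (by simp; omega)
  have h1 := h.le _ _ _ hrep hb
  rw [Finset.card_union_of_disjoint] at h1
  swap
  · refine Disjoint.mono_right hT ?_
    simp [hzw₁, hw₁B]
  have hT0 : T = ∅ := Finset.card_eq_zero.1 (by simp at h1; simpa using h1)
  subst hT0
  obtain ⟨U, hU⟩ : P'.Nonempty := Finset.card_pos.1 (by omega)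
  obtain ⟨hUE, hUodd, -, hUadj⟩ := hP' U hU
  have hUadj' : ∀ u ∈ U, ∀ v ∈ insert z B, v ∉ U → G.Adj u v → s(u, v) = g := by
    intro u hu v hv hvU huv
    by_contra hc
    exact hUadj u hu v hv hvU (by simp) (exchange_adj_old huv hc)
  -- One of the edges from `z` to `y₁` and `y₂` may be `g`; the other keeps `z` attached to `B`.
  obtain ⟨y, hyB, hzy, hyg⟩ : ∃ y ∈ B, G.Adj z y ∧ s(z, y) ≠ g := by
    by_cases hc : s(z, y₁) = g
    · refine ⟨y₂, hy₂, hzy₂, ?_⟩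
      rintro rfl
      rw [Sym2.eq_iff] at hc
      rcases hc with hc | hc
      · exact hy hc.2
      · exact hzy₂.ne hc.1
    · exact ⟨y₁, hy₁, hzy₁, hc⟩
  have hzyU : z ∈ U ↔ y ∈ U := by
    constructor
    · intro hzU
      by_contra hyU
      exact hyg (hUadj' z hzU y (by simp [hyB]) hyU hzy)
    · intro hyU
      by_contra hzU
      exact hyg (by rw [Sym2.eq_swap]; exact hUadj' y hyU z (by simp) hzU hzy.symm)
  have h2 := eq_empty_or_eq_of_factorCritical (U := U ∩ B) h.odd_B h.matchable g
    Finset.inter_subset_right (by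
      intro u hu v hv hvU huv
      rw [Finset.mem_inter] at hu hvU
      exact hUadj' u hu.1 v (by simp [hv]) (fun hc => hvU ⟨hc, hv⟩) huv)
  rcases h2 with h2 | h2
  · have hyU : y ∉ U := fun hc => by
      have : y ∈ U ∩ B := Finset.mem_inter.2 ⟨hc, hyB⟩
      simp [h2] at this
    obtain ⟨u, hu⟩ := Finset.card_pos.1 hUodd.pos
    have := hUE hu
    rw [Finset.mem_insert] at this
    rcases this with rfl | hB
    · exact hyU (hzyU.1 hu)
    · have : u ∈ U ∩ B := Finset.mem_inter.2 ⟨hu, hB⟩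
      simp [h2] at this
  · have hBU : B ⊆ U := by
      rw [← h2]
      exact Finset.inter_subset_left
    have : U = insert z B :=
      hUE.antisymm (Finset.insert_subset (hzyU.2 (hBU hyB)) hBU)
    rw [this] at hUodd
    exact (Nat.not_odd_iff_even.2 hev) hUodd

/-- The case of a single vertex `z` in `S` that is adjacent to all of `W`. -/
theorem false_of_singleton_of_adj [Fintype V] {z w₁ w₂ y : V}
    (h : IsCriticalPartition χ G {z} W B)
    (hbad : ∀ G, IsRepresenting χ G → ¬ IsMatchable G Finset.univ)
    (hW : W = {w₁, w₂}) (hne : w₁ ≠ w₂) (hz₁ : G.Adj z w₁) (hz₂ : G.Adj z w₂) (hy : y ∈ B)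
    (hzy : G.Adj z y) (hB : 2 ≤ B.card) : False := by
  have hw₁ : w₁ ∈ W := by simp [hW]
  have hw₂ : w₂ ∈ W := by simp [hW]
  have hzB : z ∉ B := by simpa using h.disjSB
  have hzW : z ∉ W := by simpa using h.disjSW
  have hw₁B : w₁ ∉ B := Finset.disjoint_left.1 h.disjWB hw₁
  have hw₂B : w₂ ∉ B := Finset.disjoint_left.1 h.disjWB hw₂
  -- The matching edge `x₁x₂` of `B \ {y}` is given up: `w₁` and `w₂` are matched to `x₁` and `x₂`,
  -- and `z` to `y`. The new edges are paid for with `zw₂` and `zw₁`.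
  obtain ⟨x₁, x₂, hx, hx₁, hx₂, hrest⟩ := (h.matchable y hy).exists_pair
    (Finset.card_pos.1 (by rw [Finset.card_erase_of_mem hy]; omega))
  rw [Finset.mem_erase] at hx₁ hx₂
  have key : ∀ u v x, W = {u, v} → u ≠ v → G.Adj z v → x ∈ B → χ s(z, v) = χ s(u, x) := by
    intro u v x hW' huv hzv hxB
    have hu : u ∈ W := by simp [hW']
    obtain ⟨g, hg, hgc⟩ := h.rep.exists_eq s(u, x) (by
      rw [Sym2.mk_isDiag_iff]
      rintro rfl
      exact Finset.disjoint_left.1 h.disjWB hu hxB)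
    have h1 := h.not_isMatchable_deleteEdges hbad hu hxB hg hgc
    have h2 : W.erase u = {v} := by
      rw [hW', Finset.erase_insert (by simpa using huv)]
    rw [h2] at h1
    by_contra hc
    refine h1 (IsMatchable.pair (a := z) (b := v) ?_)
    rw [deleteEdges_adj]
    refine ⟨hzv, ?_⟩
    rintro rfl
    exact hc hgc
  have hc₁ := key w₁ w₂ x₁ hW hne hz₂ hx₁.2
  have hc₂ := key w₂ w₁ x₂ (by rw [hW, Finset.pair_comm]) hne.symm hz₁ hx₂.2
  have e₁ : w₁ ≠ x₁ := by rintro rfl; exact hw₁B hx₁.2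
  have e₂ : w₂ ≠ x₂ := by rintro rfl; exact hw₂B hx₂.2
  have e₃ : w₁ ≠ x₂ := by rintro rfl; exact hw₁B hx₂.2
  have e₄ : w₂ ≠ x₁ := by rintro rfl; exact hw₂B hx₁.2
  have f₁ : z ≠ x₁ := by rintro rfl; exact hzB hx₁.2
  have f₂ : z ≠ x₂ := by rintro rfl; exact hzB hx₂.2
  have f₃ : y ≠ w₁ := by rintro rfl; exact hw₁B hy
  have f₄ : y ≠ w₂ := by rintro rfl; exact hw₂B hy
  have hr₁ := h.rep.exchange (e := s(w₁, x₁)) (by simpa using e₁) hz₂ hc₁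
  have hr₂ := hr₁.exchange (e := s(w₂, x₂)) (g := s(z, w₁)) (by simpa using e₂)
    (exchange_adj_old hz₁ (by simp [hne, hz₁.ne.symm])) hc₂
  refine hbad _ hr₂ ?_
  have h0 := hrest.mono_on (G' := exchange (exchange G s(w₁, x₁) s(z, w₂)) s(w₂, x₂) s(z, w₁)) (by
    intro a ha b hb hab
    simp only [Finset.mem_erase] at ha hb
    have : a ≠ z := by rintro rfl; exact hzB ha.2.2.2
    have : b ≠ z := by rintro rfl; exact hzB hb.2.2.2
    refine exchange_adj_old (exchange_adj_old hab ?_) ?_ <;> simp [*])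
  have h1 := IsMatchable.insert_pair (a := w₁) (b := x₁) (by
    refine exchange_adj_old (exchange_adj_new e₁) ?_
    simp [hz₁.ne.symm, f₁.symm]) (by simp [hw₁B]) (by simp) h0
  have h2 := IsMatchable.insert_pair (a := w₂) (b := x₂) (exchange_adj_new e₂)
    (by simp [hw₂B, hne.symm, e₄]) (by simp [e₃.symm, hx.ne.symm]) h1
  have h3 := IsMatchable.insert_pair (a := z) (b := y) (by
    refine exchange_adj_old (exchange_adj_old hzy ?_) ?_ <;> simp [f₃, f₄, hz₁.ne, hz₂.ne])
    (by simp [hzB, hz₁.ne, hz₂.ne, f₁, f₂])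
    (by simp [f₃, f₄, hx₁.1.symm, hx₂.1.symm]) h2
  convert h3 using 1
  ext v
  have := h.cover v
  simp only [hW, Finset.mem_singleton, Finset.mem_insert] at this
  simp only [Finset.mem_univ, Finset.mem_insert, Finset.mem_erase, true_iff]
  tauto

/-- The case of two vertices in `S`. -/
theorem false_of_card_eq_two [Fintype V] {s : ℕ} (h : IsCriticalPartition χ G S W B)
    (hbad : ∀ G, IsRepresenting χ G → ¬ IsMatchable G Finset.univ) (hs : 6 ≤ s)
    (hV : Fintype.card V = 2 * s) (hS : S.card = 2)
    (hm : (S.offDiag.filter fun p => ¬ G.Adj p.1 p.2).card +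
      2 * ((S ×ˢ W).filter fun p => ¬ G.Adj p.1 p.2).card +
      2 * ((S ×ˢ B).filter fun p => ¬ G.Adj p.1 p.2).card +
      (B.offDiag.filter fun p => ¬ G.Adj p.1 p.2).card ≤ 6) : False := by
  have hB := h.card_B hV
  have hWm := h.card_le_card_nonadj hbad hS.ge
  have hW := h.card_W
  -- a vertex of `S` together with `B` remains matchable when an edge is deleted
  have hmat : ∀ z ∈ S, ∀ g, IsMatchable (G.deleteEdges {g}) (insert z B) := by
    intro z hz g
    have hzB : z ∉ B := Finset.disjoint_left.1 h.disjSB hz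
    -- Pairs between `S` and `W` use at least 4 of the 6 allowed by `hm`, so at most 2 ordered pairs
    -- are left here; `2 + 1 < s - 2` is where `s ≥ 6` enters.
    refine isMatchable_deleteEdges_of_card_lt (p := s - 2) ?_ ?_ g
    · rw [Finset.card_insert_of_notMem hzB]
      omega
    · have h1 : ((insert z B).offDiag.filter fun p => ¬ G.Adj p.1 p.2) ⊆
          (B.offDiag.filter fun p => ¬ G.Adj p.1 p.2) ∪
          (((S ×ˢ B).filter fun p => ¬ G.Adj p.1 p.2) ∪
          ((S ×ˢ B).filter fun p => ¬ G.Adj p.1 p.2).image Prod.swap) := by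
        rintro ⟨a, b⟩ hp
        simp only [Finset.mem_filter, Finset.mem_offDiag, Finset.mem_insert] at hp
        simp only [Finset.mem_union, Finset.mem_filter, Finset.mem_offDiag, Finset.mem_product,
          Finset.mem_image, Prod.exists, Prod.swap_prod_mk, Prod.mk.injEq]
        obtain ⟨⟨ha, hb, hab⟩, hnadj⟩ := hp
        rcases ha with rfl | ha <;> rcases hb with rfl | hb
        · exact absurd rfl hab
        · exact .inr (.inl ⟨⟨hz, hb⟩, hnadj⟩)
        · exact .inr (.inr ⟨b, a, ⟨⟨hz, ha⟩, fun hc => hnadj hc.symm⟩, rfl, rfl⟩)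
        · exact .inl ⟨⟨ha, hb, hab⟩, hnadj⟩
      have h2 := Finset.card_le_card h1
      have h3 := (Finset.card_union_le (B.offDiag.filter fun p => ¬ G.Adj p.1 p.2)
        (((S ×ˢ B).filter fun p => ¬ G.Adj p.1 p.2) ∪
          ((S ×ˢ B).filter fun p => ¬ G.Adj p.1 p.2).image Prod.swap))
      have h4 := Finset.card_union_le ((S ×ˢ B).filter fun p => ¬ G.Adj p.1 p.2)
          (((S ×ˢ B).filter fun p => ¬ G.Adj p.1 p.2).image Prod.swap)
      have h5 := Finset.card_image_le (s := (S ×ˢ B).filter fun p => ¬ G.Adj p.1 p.2)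
        (f := Prod.swap)
      omega
  -- Otherwise the exchange brings in `w₁w₂` and spares `zw₃`, and the other vertex of `S` is
  -- matched together with `B`.
  have key : ∀ w₁ w₂ w₃, W = {w₁, w₂, w₃} → w₁ ≠ w₂ → w₁ ≠ w₃ → w₂ ≠ w₃ → ∀ z ∈ S,
      G.Adj z w₃ → ∀ g ∈ G.edgeSet, χ g = χ s(w₁, w₂) → g = s(z, w₃) := by
    intro w₁ w₂ w₃ hWe h₁₂ h₁₃ h₂₃ z hz hzw g hg hgc
    by_contra hne
    have hrep := h.rep.exchange (e := s(w₁, w₂)) (by simpa using h₁₂) hg hgc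
    obtain ⟨z', hz'⟩ : ∃ z', S.erase z = {z'} :=
      Finset.card_eq_one.1 (by rw [Finset.card_erase_of_mem hz, hS])
    have hz'S : z' ∈ S.erase z := by simp [hz']
    rw [Finset.mem_erase] at hz'S
    have hSW : ∀ u ∈ S, u ≠ w₁ ∧ u ≠ w₂ ∧ u ≠ w₃ := by
      intro u hu
      have := Finset.disjoint_left.1 h.disjSW hu
      simpa [hWe] using this
    have hBW : w₁ ∉ B ∧ w₂ ∉ B ∧ w₃ ∉ B := by
      refine ⟨?_, ?_, ?_⟩ <;> exact Finset.disjoint_left.1 h.disjWB (by simp [hWe])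
    have hzB : z ∉ B := Finset.disjoint_left.1 h.disjSB hz
    have h0 := (hmat z' hz'S.2 g).mono (deleteEdges_le_exchange G s(w₁, w₂) g)
    have h1 := IsMatchable.insert_pair (a := z) (b := w₃)
      (exchange_adj_old hzw (fun hc => hne hc.symm)) (by simp [hz'S.1.symm, hzB])
      (by simp [(hSW z' hz'S.2).2.2.symm, hBW]) h0
    have h2 := IsMatchable.insert_pair (a := w₁) (b := w₂) (exchange_adj_new h₁₂)
      (by simp [hBW, (hSW z hz).1.symm, (hSW z' hz'S.2).1.symm, h₁₃])
      (by simp [hBW, (hSW z hz).2.1.symm, (hSW z' hz'S.2).2.1.symm, h₂₃]) h1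
    refine hbad _ hrep ?_
    convert h2 using 1
    ext v
    have h3 : v ∈ S ↔ v = z ∨ v = z' := by
      rw [← Finset.insert_erase hz, hz']
      simp
    have := h.cover v
    simp only [hWe, h3, Finset.mem_insert, Finset.mem_singleton] at this
    simp only [Finset.mem_univ, Finset.mem_insert, true_iff]
    tauto
  rw [hS] at hW
  obtain ⟨w₁, w₂, w₃, h₁₂, h₁₃, h₂₃, hWe⟩ := Finset.card_eq_three.1 hW
  -- If both vertices of `S` were adjacent to `w`, `key` would identify `g` with two different
  -- edges.
  have hle : ∀ u v w, W = {u, v, w} → u ≠ v → u ≠ w → v ≠ w →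
      1 ≤ (S.filter fun z => ¬ G.Adj z w).card := by
    intro u v w hWe' huv huw hvw
    rw [Nat.one_le_iff_ne_zero, Ne, Finset.card_eq_zero, Finset.filter_eq_empty_iff]
    intro hall
    obtain ⟨z, z', hzz, rfl⟩ := Finset.card_eq_two.1 hS
    obtain ⟨g, hg, hgc⟩ := h.rep.exists_eq s(u, v) (by simpa using huv)
    have a1 : G.Adj z w := not_not.1 (hall (by simp))
    have a2 : G.Adj z' w := not_not.1 (hall (by simp))
    have k1 := key u v w hWe' huv huw hvw z (by simp) a1 g hg hgc
    have k2 := key u v w hWe' huv huw hvw z' (by simp) a2 g hg hgc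
    rw [k1, Sym2.eq_iff] at k2
    rcases k2 with k2 | k2
    · exact hzz k2.1
    · exact a1.ne k2.1
  have p₁ : W = {w₂, w₃, w₁} := by
    rw [hWe]
    ext v
    simp
    tauto
  have p₂ : W = {w₁, w₃, w₂} := by
    rw [hWe]
    ext v
    simp
    tauto
  have l₁ := hle w₂ w₃ w₁ p₁ h₂₃ h₁₂.symm h₁₃.symm
  have l₂ := hle w₁ w₃ w₂ p₂ h₁₃ h₁₂ h₂₃.symm
  have l₃ := hle w₁ w₂ w₃ hWe h₁₂ h₁₃ h₂₃
  have hsum : ((S ×ˢ W).filter fun p => ¬ G.Adj p.1 p.2).card =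
      (S.filter fun z => ¬ G.Adj z w₁).card + (S.filter fun z => ¬ G.Adj z w₂).card +
      (S.filter fun z => ¬ G.Adj z w₃).card := by
    rw [Finset.card_filter, Finset.sum_product_right, hWe,
      Finset.sum_insert (by simp [h₁₂, h₁₃]), Finset.sum_insert (by simp [h₂₃]),
      Finset.sum_singleton, ← Finset.card_filter, ← Finset.card_filter, ← Finset.card_filter]
    ring
  have hex : ∀ w, (S.filter fun z => ¬ G.Adj z w).card = 1 → ∃ z ∈ S, G.Adj z w := by
    intro w hw
    by_contra! hc
    rw [Finset.filter_true_of_mem hc] at hw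
    omega
  obtain ⟨z₁, hz₁, a₁⟩ := hex w₁ (by omega)
  obtain ⟨z₂, hz₂, a₂⟩ := hex w₂ (by omega)
  obtain ⟨z₃, hz₃, a₃⟩ := hex w₃ (by omega)
  have hcol : ∀ u v w z, W = {u, v, w} → u ≠ v → u ≠ w → v ≠ w → z ∈ S → G.Adj z w →
      χ s(z, w) = χ s(u, v) := by
    intro u v w z hWe' huv huw hvw hz hzw
    obtain ⟨g, hg, hgc⟩ := h.rep.exists_eq s(u, v) (by simpa using huv)
    rw [← key u v w hWe' huv huw hvw z hz hzw g hg hgc, hgc]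
  have c₁ := hcol w₂ w₃ w₁ z₁ p₁ h₂₃ h₁₂.symm h₁₃.symm hz₁ a₁
  have c₂ := hcol w₁ w₃ w₂ z₂ p₂ h₁₃ h₁₂ h₂₃.symm hz₂ a₂
  have c₃ := hcol w₁ w₂ w₃ z₃ hWe h₁₂ h₁₃ h₂₃ hz₃ a₃
  have hSW : ∀ u ∈ S, u ≠ w₁ ∧ u ≠ w₂ ∧ u ≠ w₃ := by
    intro u hu
    have := Finset.disjoint_left.1 h.disjSW hu
    simpa [hWe] using this
  -- Each vertex of `W` has exactly one neighbour in `S`, by an edge of the color of the opposite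
  -- side of `W`. Exchanging all three edges turns `W` into a triangle.
  have hr₁ := h.rep.exchange (e := s(w₂, w₃)) (by simpa using h₂₃) a₁ c₁
  have hr₂ := hr₁.exchange (e := s(w₁, w₃)) (g := s(z₂, w₂)) (by simpa using h₁₃)
    (exchange_adj_old a₂ (by simp [h₁₂.symm, hSW z₂ hz₂])) c₂
  have hr₃ := hr₂.exchange (e := s(w₁, w₂)) (g := s(z₃, w₃)) (by simpa using h₁₂)
    (exchange_adj_old (exchange_adj_old a₃ (by simp [h₁₃.symm, hSW z₃ hz₃]))
      (by simp [h₂₃.symm, hSW z₃ hz₃])) c₃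
  -- The three nonadjacent pairs between `S` and `W` exhaust the 6 allowed by `hm`, so `S ∪ B` is a
  -- clique.
  have e1 : (S.offDiag.filter fun p => ¬ G.Adj p.1 p.2) = ∅ := Finset.card_eq_zero.1 (by omega)
  have e2 : ((S ×ˢ B).filter fun p => ¬ G.Adj p.1 p.2) = ∅ := Finset.card_eq_zero.1 (by omega)
  have e3 : (B.offDiag.filter fun p => ¬ G.Adj p.1 p.2) = ∅ := Finset.card_eq_zero.1 (by omega)
  rw [Finset.filter_eq_empty_iff] at e1 e2 e3
  have hclique : ∀ a ∈ S ∪ B, ∀ b ∈ S ∪ B, a ≠ b → G.Adj a b := by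
    intro a ha b hb hab
    rw [Finset.mem_union] at ha hb
    rcases ha with ha | ha <;> rcases hb with hb | hb
    · exact not_not.1 (e1 (x := (a, b)) (by simp [ha, hb, hab]))
    · exact not_not.1 (e2 (x := (a, b)) (by simp [ha, hb]))
    · exact (not_not.1 (e2 (x := (b, a)) (by simp [ha, hb]))).symm
    · exact not_not.1 (e3 (x := (a, b)) (by simp [ha, hb, hab]))
  have hY : ∀ v, v ∈ S ∪ B ↔ v ≠ w₁ ∧ v ≠ w₂ ∧ v ≠ w₃ := by
    intro v
    have h1 : v ∈ W ↔ v = w₁ ∨ v = w₂ ∨ v = w₃ := by simp [hWe]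
    have h2 := h.cover v
    have h3 : v ∈ S → v ∉ W := fun hv => Finset.disjoint_left.1 h.disjSW hv
    have h4 : v ∈ W → v ∉ B := fun hv => Finset.disjoint_left.1 h.disjWB hv
    rw [Finset.mem_union]
    tauto
  have n₁ := hSW z₁ hz₁
  have n₂ := hSW z₂ hz₂
  have n₃ := hSW z₃ hz₃
  refine false_of_triangle_and_clique (by omega) hV hbad hr₃ (w₁ := w₁) (w₂ := w₂) (w₃ := w₃)
    (exchange_adj_new h₁₂) ?_ ?_ hY ?_
  · exact exchange_adj_old (exchange_adj_new h₁₃) (by simp [n₃.1.symm, h₁₃])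
  · refine exchange_adj_old (exchange_adj_old (exchange_adj_new h₂₃) ?_) ?_ <;>
      simp [n₂.2.1.symm, n₂.2.2.symm, n₃.2.1.symm, n₃.2.2.symm]
  · intro a ha b hb hab
    have ha' := (hY a).1 ha
    have hb' := (hY b).1 hb
    refine exchange_adj_old (exchange_adj_old (exchange_adj_old (hclique a ha b hb hab) ?_) ?_) ?_
      <;> simp [ha', hb']

end IsCriticalPartition

/-- An edge-coloring of the complete graph on `2 s` vertices with many colors has a rainbow
perfect matching. -/
theorem exists_isRepresenting_isMatchable [Fintype V] {s : ℕ} (hs : 3 ≤ s)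
    (hV : Fintype.card V = 2 * s)
    (h1 : 4 * (s : ℤ) ^ 2 - 14 * s + 18 ≤ 2 * (χ '' {e | ¬ e.IsDiag}).ncard)
    (h2 : 3 * (s : ℤ) ^ 2 - 5 * s + 2 ≤ 2 * (χ '' {e | ¬ e.IsDiag}).ncard) :
    ∃ G, IsRepresenting χ G ∧ IsMatchable G Finset.univ := by
  by_contra! hbad
  obtain ⟨G, S, W, B, h, hS⟩ := exists_isCriticalPartition hbad hV h1 h2
  have hcnt := h.card_nonadj_le hV
  have hB := h.card_B hV
  have hW := h.card_W
  have hSpos := Finset.card_pos.2 hS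
  have hBpos := h.odd_B.pos
  rcases Nat.lt_or_ge S.card 2 with hq1 | hq2
  · have hS1 : S.card = 1 := by omega
    rw [hS1] at hcnt hW hB
    obtain ⟨z, rfl⟩ := Finset.card_eq_one.1 hS1
    -- So `z` misses at most `2s - 4` vertices of `W ∪ B`, while `|B| = 2s - 3`: it has a neighbour
    -- in `B`, and two if it misses a vertex of `W`.
    have hzm : 2 * (({z} ×ˢ W).filter fun p => ¬ G.Adj p.1 p.2).card +
        2 * (({z} ×ˢ B).filter fun p => ¬ G.Adj p.1 p.2).card + 8 ≤ 4 * s := by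
      zify
      push_cast at hcnt
      linarith
    have hzB : (({z} ×ˢ B).filter fun p => G.Adj p.1 p.2).card =
        (B.filter fun y => G.Adj z y).card := by
      rw [Finset.card_filter, Finset.sum_product, Finset.sum_singleton, ← Finset.card_filter]
    have hadd := card_adj_add_card_nonadj G ({z} ×ˢ B)
    rw [hzB, Finset.card_product, Finset.card_singleton, one_mul] at hadd
    obtain ⟨w₁, w₂, hne, hWe⟩ := Finset.card_eq_two.1 hW
    have hcase : ∀ u v, W = {u, v} → u ≠ v → ¬ G.Adj z v → False := by
      intro u v hWe' huv hzv
      have h3 : (({z} ×ˢ W).filter fun p => ¬ G.Adj p.1 p.2).Nonempty :=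
        ⟨(z, v), by simp [hWe', hzv]⟩
      have h4 := Finset.card_pos.2 h3
      obtain ⟨y₁, hy₁, y₂, hy₂, hy⟩ := Finset.one_lt_card.1
        (show 1 < (B.filter fun y => G.Adj z y).card by omega)
      rw [Finset.mem_filter] at hy₁ hy₂
      exact h.false_of_singleton_of_not_adj hbad hWe' huv hzv hy₁.1 hy₂.1 hy hy₁.2 hy₂.2
    by_cases hz₂ : G.Adj z w₂
    · by_cases hz₁ : G.Adj z w₁
      · obtain ⟨y, hy⟩ := Finset.card_pos.1
          (show 0 < (B.filter fun y => G.Adj z y).card by omega)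
        rw [Finset.mem_filter] at hy
        exact h.false_of_singleton_of_adj hbad hWe hne hz₁ hz₂ hy.1 hy.2 (by omega)
      · exact hcase w₂ w₁ (by rw [hWe, Finset.pair_comm]) hne.symm hz₁
    · exact hcase w₁ w₂ hWe hne hz₂
  have hm := h.card_le_card_nonadj hbad hq2
  have hmz : (S.card : ℤ) ≤ ((S ×ˢ W).filter fun p => ¬ G.Adj p.1 p.2).card := by
    exact_mod_cast hm
  -- Here `s = |S| + 1`, and `|S|` nonadjacent pairs would give only equality in `h2`; the
  -- additional pair of `card_lt_card_nonadj` is decisive.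
  by_cases hB1 : B.card = 1
  · obtain ⟨x, rfl⟩ := Finset.card_eq_one.1 hB1
    have h3 := h.card_lt_card_nonadj hbad hq2
    have h4 : ((S ×ˢ (insert x W)).filter fun p => ¬ G.Adj p.1 p.2).card ≤
        ((S ×ˢ W).filter fun p => ¬ G.Adj p.1 p.2).card +
        ((S ×ˢ {x}).filter fun p => ¬ G.Adj p.1 p.2).card := by
      refine (Finset.card_le_card ?_).trans (Finset.card_union_le _ _)
      intro p hp
      simp only [Finset.mem_filter, Finset.mem_product, Finset.mem_insert, Finset.mem_union,
        Finset.mem_singleton] at hp ⊢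
      tauto
    have h5 : (S.card : ℤ) + 1 ≤ ((S ×ˢ W).filter fun p => ¬ G.Adj p.1 p.2).card +
        ((S ×ˢ {x}).filter fun p => ¬ G.Adj p.1 p.2).card := by
      exact_mod_cast h3.trans_le h4
    have h6 : (s : ℤ) = S.card + 1 := by
      have : s = S.card + 1 := by omega
      exact_mod_cast this
    rw [h6] at hcnt h2
    nlinarith
  have hqs : (S.card : ℤ) + 2 ≤ s := by
    have : S.card + 2 ≤ s := by
      have := h.odd_B
      rw [Nat.odd_iff] at this
      omega
    exact_mod_cast this
  rcases Nat.lt_or_ge S.card 3 with hq3 | hq3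
  · have hS2 : S.card = 2 := by omega
    rw [hS2] at hcnt hmz hqs
    push_cast at hcnt hmz hqs
    have hs6 : 6 ≤ s := by
      by_contra hlt
      have h7 : s = 4 ∨ s = 5 := by omega
      rcases h7 with rfl | rfl <;> · push_cast at hcnt h2; linarith
    refine h.false_of_card_eq_two hbad hs6 hV hS2 ?_
    zify
    linarith
  · have hq3' : (3 : ℤ) ≤ S.card := by exact_mod_cast hq3
    set q : ℤ := (S.card : ℤ)
    -- This comes from `h2` and yields `s ≥ 3q`. With `h10`, which comes from `h1`, it gives `9q² -
    -- 27q + 16 ≤ 0`, false for `q ≥ 3`.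
    have h8 : 0 ≤ ((s : ℤ) - q - 1) * (s - 3 * q) := by nlinarith
    have h9 : 3 * q ≤ s := by
      by_contra! hlt
      nlinarith [mul_pos (by linarith : 0 < (s : ℤ) - q - 1) (by linarith : 0 < 3 * q - s)]
    have h10 : 4 * (s : ℤ) * (q - 2) ≤ 3 * q ^ 2 + 3 * q - 16 := by nlinarith
    nlinarith [mul_le_mul_of_nonneg_right h9 (by linarith : 0 ≤ q - 2)]

end Upper

/-! ### From a perfect matching to the linear forest -/

section Embedding

open scoped Classical

/-- A matching can be enlarged inside `Y ∪ U`, unless at least half of the pairs between `U` and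
`Y` are nonadjacent. -/
theorem IsMatchable.exists_augmentation_or {ι : Type*} {Q : SimpleGraph ι} {Y : Finset ι}
    (hY : IsMatchable Q Y) (U : Finset ι) (hU : 2 ≤ U.card) (hd : Disjoint U Y) :
    (∃ Y' ⊆ Y ∪ U, IsMatchable Q Y' ∧ Y'.card = Y.card + 2) ∨
      U.card * Y.card ≤ 2 * ((U ×ˢ Y).filter fun p => ¬ Q.Adj p.1 p.2).card := by
  induction hY with
  | empty => simp
  | @insert_pair X a b hab ha hb hX ih =>
    rw [Finset.disjoint_insert_right, Finset.disjoint_insert_right] at hd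
    have ha' : a ∉ insert b X := by simp [ha, hab.ne]
    have hcard : (insert a (insert b X)).card = X.card + 2 := by
      rw [Finset.card_insert_of_notMem ha', Finset.card_insert_of_notMem hb]
    -- If this fails, at most `|U|` of the `2|U|` pairs between `U` and `{a, b}` are adjacent; `|U|
    -- ≥ 2` covers a single common neighbour.
    by_cases haug : ∃ u ∈ U, ∃ v ∈ U, u ≠ v ∧ Q.Adj u a ∧ Q.Adj v b
    · obtain ⟨u, hu, v, hv, huv, hua, hvb⟩ := haug
      have huX : u ∉ X := Finset.disjoint_left.1 hd.2.2 hu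
      have hvX : v ∉ X := Finset.disjoint_left.1 hd.2.2 hv
      have hau : a ≠ u := by rintro rfl; exact hd.1 hu
      have hav : a ≠ v := by rintro rfl; exact hd.1 hv
      have hbu : b ≠ u := by rintro rfl; exact hd.2.1 hu
      have hbv : b ≠ v := by rintro rfl; exact hd.2.1 hv
      left
      refine ⟨insert u (insert a (insert v (insert b X))), ?_, ?_, ?_⟩
      · intro x
        simp only [Finset.mem_insert, Finset.mem_union]
        rintro (rfl | rfl | rfl | rfl | h) <;> tauto
      · exact .insert_pair hua (by simp [huv, hbu.symm, huX]) (by simp [hav, hab.ne, ha])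
          (.insert_pair hvb hvX hb hX)
      · rw [hcard, Finset.card_insert_of_notMem (by simp [huv, hau.symm, hbu.symm, huX]),
          Finset.card_insert_of_notMem (by simp [hav, hab.ne, ha]),
          Finset.card_insert_of_notMem (by simp [hbv.symm, hvX]),
          Finset.card_insert_of_notMem hb]
    · rcases ih hd.2.2 with ⟨Y', hY', hm, hc⟩ | hle
      · left
        have haY : a ∉ Y' := fun h => by
          have := hY' h
          simp only [Finset.mem_union] at this
          tauto
        have hbY : b ∉ Y' := fun h => by
          have := hY' h
          simp only [Finset.mem_union] at this
          tauto
        refine ⟨insert a (insert b Y'), ?_, .insert_pair hab haY hbY hm, ?_⟩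
        · intro x
          have : x ∈ Y' → x ∈ X ∪ U := fun h => hY' h
          simp only [Finset.mem_insert, Finset.mem_union] at this ⊢
          tauto
        · rw [hcard, Finset.card_insert_of_notMem (by simp [haY, hab.ne]),
            Finset.card_insert_of_notMem hbY, hc]
      · right
        have hsum : ((U ×ˢ (insert a (insert b X))).filter fun p => ¬ Q.Adj p.1 p.2).card =
            (U.filter fun u => ¬ Q.Adj u a).card + ((U.filter fun u => ¬ Q.Adj u b).card +
            ((U ×ˢ X).filter fun p => ¬ Q.Adj p.1 p.2).card) := by
          have hs : ∀ Z : Finset ι, ((U ×ˢ Z).filter fun p => ¬ Q.Adj p.1 p.2).card =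
              ∑ z ∈ Z, (U.filter fun u => ¬ Q.Adj u z).card := by
            intro Z
            rw [Finset.card_filter, Finset.sum_product_right]
            simp only [Finset.card_filter]
          rw [hs, hs, Finset.sum_insert ha', Finset.sum_insert hb]
        have h1 := Finset.card_filter_add_card_filter_not (s := U) fun u => Q.Adj u a
        have h2 := Finset.card_filter_add_card_filter_not (s := U) fun u => Q.Adj u b
        have h3 : (U.filter fun u => Q.Adj u a).card + (U.filter fun u => Q.Adj u b).card ≤
            U.card := by
          push Not at haug
          rcases (U.filter fun u => Q.Adj u a).eq_empty_or_nonempty with h0 | ⟨u, hu⟩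
          · rw [h0, Finset.card_empty]
            omega
          rcases (U.filter fun u => Q.Adj u b).eq_empty_or_nonempty with h0 | ⟨v, hv⟩
          · rw [h0, Finset.card_empty]
            omega
          have h4 : (U.filter fun u => Q.Adj u a).card ≤ 1 := by
            have : Nonempty ι := ⟨v⟩
            rw [Finset.card_le_one_iff_subset_singleton]
            refine ⟨v, fun x hx => ?_⟩
            rw [Finset.mem_filter] at hx hv
            rw [Finset.mem_singleton]
            by_contra hne
            exact haug x hx.1 v hv.1 hne hx.2 hv.2
          have h5 : (U.filter fun u => Q.Adj u b).card ≤ 1 := by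
            have : Nonempty ι := ⟨v⟩
            rw [Finset.card_le_one_iff_subset_singleton]
            refine ⟨u, fun x hx => ?_⟩
            rw [Finset.mem_filter] at hx hu
            rw [Finset.mem_singleton]
            by_contra hne
            exact haug u hu.1 x hx.1 (Ne.symm hne) hu.2 hx.2
          omega
        rw [hcard, hsum, mul_add]
        omega

/-- A graph on `s` vertices with fewer than `3 (s - 1) / 2` nonadjacent pairs has a matching of
every size `k` with `2 k < s`. -/
theorem exists_isMatchable_card_eq {ι : Type*} [Fintype ι] {Q : SimpleGraph ι} {k : ℕ}
    (hk : 2 * k + 1 ≤ Fintype.card ι)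
    (hQ : (((Finset.univ : Finset ι).offDiag).filter fun p => ¬ Q.Adj p.1 p.2).card + 3 <
      3 * Fintype.card ι) :
    ∃ Y, IsMatchable Q Y ∧ Y.card = 2 * k := by
  suffices h : ∀ j ≤ k, ∃ Y, IsMatchable Q Y ∧ Y.card = 2 * j from h k le_rfl
  intro j
  induction j with
  | zero => exact fun _ => ⟨∅, .empty, rfl⟩
  | succ j ih =>
    intro hj
    obtain ⟨Y, hY, hYc⟩ := ih (by omega)
    have hUc : Yᶜ.card + Y.card = Fintype.card ι := Finset.card_compl_add_card Y
    by_cases hadj : ∃ u ∈ Yᶜ, ∃ v ∈ Yᶜ, Q.Adj u v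
    · obtain ⟨u, hu, v, hv, huv⟩ := hadj
      rw [Finset.mem_compl] at hu hv
      refine ⟨insert u (insert v Y), .insert_pair huv hu hv hY, ?_⟩
      rw [Finset.card_insert_of_notMem (by simp [hu, huv.ne]), Finset.card_insert_of_notMem hv,
        hYc]
      ring
    push Not at hadj
    rcases hY.exists_augmentation_or Yᶜ (by omega) disjoint_compl_left with ⟨Y', -, hm, hc⟩ | hle
    · exact ⟨Y', hm, by omega⟩
    exfalso
    -- With `u = |Yᶜ| ≥ 3`, these are at least `u(u - 1) + u|Y| = u(|ι| - 1) ≥ 3(|ι| - 1)` ordered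
    -- pairs.
    have hsub : Yᶜ.offDiag ∪ (((Yᶜ ×ˢ Y).filter fun p => ¬ Q.Adj p.1 p.2) ∪
        ((Yᶜ ×ˢ Y).filter fun p => ¬ Q.Adj p.1 p.2).image Prod.swap) ⊆
        ((Finset.univ : Finset ι).offDiag).filter fun p => ¬ Q.Adj p.1 p.2 := by
      rintro ⟨a, b⟩ hp
      simp only [Finset.mem_union, Finset.mem_offDiag, Finset.mem_filter, Finset.mem_product,
        Finset.mem_image, Prod.exists, Prod.swap_prod_mk, Prod.mk.injEq, Finset.mem_compl] at hp
      simp only [Finset.mem_filter, Finset.mem_offDiag, Finset.mem_univ, true_and]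
      rcases hp with hp | hp | ⟨x, y, hp, rfl, rfl⟩
      · exact ⟨hp.2.2, hadj a (by simp [hp.1]) b (by simp [hp.2.1])⟩
      · refine ⟨?_, hp.2⟩
        rintro rfl
        exact hp.1.1 hp.1.2
      · refine ⟨?_, fun h => hp.2 h.symm⟩
        rintro rfl
        exact hp.1.1 hp.1.2
    have h1 := Finset.card_le_card hsub
    rw [Finset.card_union_of_disjoint, Finset.card_union_of_disjoint,
      Finset.card_image_of_injective _ Prod.swap_injective, Finset.offDiag_card] at h1
    · have h2 : Yᶜ.card ≤ Yᶜ.card * Yᶜ.card := Nat.le_mul_self _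
      have h3 : 3 ≤ Yᶜ.card := by omega
      zify [h2] at *
      nlinarith
    · rw [Finset.disjoint_left]
      rintro ⟨a, b⟩ h h'
      simp only [Finset.mem_filter, Finset.mem_product,
        Finset.mem_image, Prod.exists, Prod.swap_prod_mk, Prod.mk.injEq, Finset.mem_compl] at h h'
      obtain ⟨x, y, h', rfl, rfl⟩ := h'
      exact h.1.1 h'.1.2
    · rw [Finset.disjoint_left]
      rintro ⟨a, b⟩ h h'
      simp only [Finset.mem_filter, Finset.mem_product, Finset.mem_union, Finset.mem_offDiag,
        Finset.mem_image, Prod.exists, Prod.swap_prod_mk, Prod.mk.injEq, Finset.mem_compl] at h h'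
      rcases h' with h' | ⟨x, y, h', rfl, rfl⟩
      · exact h.2.1 h'.1.2
      · exact h.1 h'.1.2

/-- The graph `k P₄ ∪ t P₂` embeds into a graph with many edges and a perfect matching. -/
theorem exists_injective_linearForest {V : Type*} [Fintype V] {G : SimpleGraph V} {k t : ℕ}
    (ht : 1 ≤ t) (hV : Fintype.card V = 4 * k + 2 * t) (hG : IsMatchable G Finset.univ)
    (hcard : 4 * (2 * k + t : ℤ) ^ 2 - 14 * (2 * k + t) + 18 ≤
      ((Finset.univ : Finset (V × V)).filter fun p => G.Adj p.1 p.2).card) :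
    ∃ f : (Fin k × Fin 4) ⊕ (Fin t × Fin 2) → V, Function.Injective f ∧
      ∀ x y, (linearForestP4P2 k t).Adj x y → G.Adj (f x) (f y) := by
  obtain ⟨ι, _, m, hm, hr, hadj⟩ := hG.exists_family
  have hsurj : Function.Surjective m := by
    rw [← Set.range_eq_univ, hr]
    simp
  have hι : Fintype.card ι = 2 * k + t := by
    have := Fintype.card_of_bijective ⟨hm, hsurj⟩
    rw [Fintype.card_prod, Fintype.card_fin, hV] at this
    omega
  -- `Q` contracts the matching edges: an edge of `Q` links two of them to a P₄, and those outside a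
  -- matching of `Q` remain as copies of P₂.
  obtain ⟨Q, hQ⟩ : ∃ Q : SimpleGraph ι, ∀ i j, Q.Adj i j ↔
      i ≠ j ∧ ∃ a b, G.Adj (m (i, a)) (m (j, b)) :=
    ⟨{ Adj := fun i j => i ≠ j ∧ ∃ a b, G.Adj (m (i, a)) (m (j, b))
       symm := ⟨fun i j ⟨h, a, b, hab⟩ => ⟨h.symm, b, a, hab.symm⟩⟩
       loopless := ⟨fun i h => h.1 rfl⟩ }, fun _ _ => Iff.rfl⟩
  have hcount : ((Finset.univ : Finset (V × V)).filter fun p => G.Adj p.1 p.2).card ≤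
      2 * (2 * k + t) +
        4 * (((Finset.univ : Finset ι).offDiag).filter fun p => Q.Adj p.1 p.2).card := by
    let F : Finset ((ι × Fin 2) × (ι × Fin 2)) :=
      (Finset.univ : Finset (ι × Fin 2)).image (fun x => (x, (x.1, x.2 + 1))) ∪
      ((((Finset.univ : Finset ι).offDiag).filter fun p => Q.Adj p.1 p.2) ×ˢ
        (Finset.univ : Finset (Fin 2 × Fin 2))).image
          (fun x => ((x.1.1, x.2.1), (x.1.2, x.2.2)))
    have hF : F.card ≤ 2 * (2 * k + t) +
        4 * (((Finset.univ : Finset ι).offDiag).filter fun p => Q.Adj p.1 p.2).card := by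
      refine (Finset.card_union_le _ _).trans (Nat.add_le_add ?_ ?_)
      · refine Finset.card_image_le.trans ?_
        rw [Finset.card_univ, Fintype.card_prod, hι, Fintype.card_fin]
        omega
      · refine Finset.card_image_le.trans ?_
        rw [Finset.card_product, Finset.card_univ, Fintype.card_prod, Fintype.card_fin]
        omega
    refine le_trans ?_ hF
    refine (Finset.card_le_card (t := F.image fun x => (m x.1, m x.2)) ?_).trans
      Finset.card_image_le
    rintro ⟨u, v⟩ huv
    rw [Finset.mem_filter] at huv
    obtain ⟨⟨i, a⟩, rfl⟩ := hsurj u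
    obtain ⟨⟨j, b⟩, rfl⟩ := hsurj v
    rw [Finset.mem_image]
    refine ⟨((i, a), (j, b)), ?_, rfl⟩
    by_cases hij : i = j
    · subst hij
      refine Finset.mem_union_left _ (Finset.mem_image.2 ⟨(i, a), Finset.mem_univ _, ?_⟩)
      have hab : a ≠ b := by
        rintro rfl
        exact huv.2.ne rfl
      have : b = a + 1 := by omega
      rw [this]
    · refine Finset.mem_union_right _ (Finset.mem_image.2 ⟨((i, j), (a, b)), ?_, rfl⟩)
      simp only [Finset.mem_product, Finset.mem_filter, Finset.mem_offDiag, Finset.mem_univ,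
        true_and, and_true]
      exact ⟨hij, (hQ i j).2 ⟨hij, a, b, huv.2⟩⟩
  have hnon := card_adj_add_card_nonadj Q (Finset.univ : Finset ι).offDiag
  rw [Finset.offDiag_card, Finset.card_univ, hι] at hnon
  -- Two matching edges have at most four edges of `G` between them, so the bound on `G` leaves
  -- fewer than `3(s - 1)` nonadjacent ordered pairs in `Q`.
  obtain ⟨Y, hY, hYc⟩ := exists_isMatchable_card_eq (Q := Q) (k := k) (by omega) (by
    rw [hι]
    have h2 : 2 * k + t ≤ (2 * k + t) * (2 * k + t) := Nat.le_mul_self _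
    zify [h2] at *
    nlinarith)
  obtain ⟨κ, _, p, hp, hpr, hpadj⟩ := hY.exists_family
  have hκ : Fintype.card κ = k := by
    have h1 : (Finset.univ.image p).card = 2 * k := by
      rw [← hYc]
      congr 1
      ext i
      have : i ∈ Set.range p ↔ i ∈ (Y : Set ι) := by rw [hpr]
      simpa using this
    rw [Finset.card_image_of_injective _ hp, Finset.card_univ, Fintype.card_prod,
      Fintype.card_fin] at h1
    omega
  have hYt : Fintype.card {i // i ∉ Y} = t := by
    rw [Fintype.card_subtype_compl, hι, Fintype.card_coe, hYc]
    omega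
  let eκ : Fin k ≃ κ := (Fintype.equivFinOfCardEq hκ).symm
  let et : Fin t ≃ {i // i ∉ Y} := (Fintype.equivFinOfCardEq hYt).symm
  choose hne a b hab using fun l => (hQ _ _).1 (hpadj l)
  let h : Fin 4 → Fin 2 := ![0, 0, 1, 1]
  -- The linking edge is the middle edge of the P₄; adding 1 in `Fin 2` gives the other end of a
  -- matching edge.
  let c : κ → Fin 4 → Fin 2 := fun l => ![a l + 1, a l, b l, b l + 1]
  have hpY : ∀ x, p x ∈ Y := fun x => by
    have : p x ∈ Set.range p := ⟨x, rfl⟩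
    rwa [hpr] at this
  have hadj' : ∀ i (x y : Fin 2), x ≠ y → G.Adj (m (i, x)) (m (i, y)) := by
    intro i x y hxy
    have hxy' : (x = 0 ∧ y = 1) ∨ (x = 1 ∧ y = 0) := by omega
    rcases hxy' with ⟨rfl, rfl⟩ | ⟨rfl, rfl⟩
    · exact hadj i
    · exact (hadj i).symm
  refine ⟨Sum.elim (fun x => m (p (eκ x.1, h x.2), c (eκ x.1) x.2))
    (fun x => m ((et x.1).1, x.2)), ?_, ?_⟩
  · rintro (⟨l, x⟩ | ⟨l, x⟩) (⟨l', y⟩ | ⟨l', y⟩) hxy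
    · simp only [Sum.elim_inl] at hxy
      have h1 := hm hxy
      rw [Prod.mk.injEq] at h1
      have h2 := hp h1.1
      rw [Prod.mk.injEq] at h2
      have h3 : l = l' := eκ.injective h2.1
      subst h3
      have h4 := h1.2
      have h5 := h2.2
      have : x = y := by
        fin_cases x <;> fin_cases y <;> simp [h, c] at h4 h5 ⊢
      rw [this]
    · simp only [Sum.elim_inl, Sum.elim_inr] at hxy
      have h1 : p (eκ l, h x) = (et l').1 := congrArg Prod.fst (hm hxy)
      exact absurd (h1 ▸ hpY (eκ l, h x)) (et l').2
    · simp only [Sum.elim_inl, Sum.elim_inr] at hxy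
      have h1 : (et l).1 = p (eκ l', h y) := congrArg Prod.fst (hm hxy)
      exact absurd (h1 ▸ hpY (eκ l', h y)) (et l).2
    · simp only [Sum.elim_inr] at hxy
      have h1 := hm hxy
      rw [Prod.mk.injEq] at h1
      have h3 : l = l' := et.injective (Subtype.ext h1.1)
      rw [h3, h1.2]
  · rintro (⟨l, x⟩ | ⟨l, x⟩) (⟨l', y⟩ | ⟨l', y⟩) hxy
    · simp only [linearForestP4P2, nCopies, sum_adj, boxProd_adj, bot_adj, false_and, false_or,
        pathGraph_adj] at hxy
      obtain ⟨hxy, rfl⟩ := hxy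
      simp only [Sum.elim_inl]
      have e1 : G.Adj (m (p (eκ l, 0), a (eκ l) + 1)) (m (p (eκ l, 0), a (eκ l))) :=
        hadj' _ _ _ (by omega)
      have e2 : G.Adj (m (p (eκ l, 1), b (eκ l))) (m (p (eκ l, 1), b (eκ l) + 1)) :=
        hadj' _ _ _ (by omega)
      have e3 := hab (eκ l)
      fin_cases x <;> fin_cases y <;> simp at hxy <;> simp only [h, c] <;>
        first | exact e1 | exact e2 | exact e3 | exact e1.symm | exact e2.symm | exact e3.symm
    · simp [linearForestP4P2] at hxy
    · simp [linearForestP4P2] at hxy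
    · simp only [linearForestP4P2, nCopies, sum_adj, boxProd_adj, bot_adj, false_and, false_or,
        pathGraph_adj] at hxy
      obtain ⟨hxy, rfl⟩ := hxy
      exact hadj' _ _ _ (by rintro rfl; simp at hxy)

/-- Every edge-coloring of the complete graph with many colors has a rainbow copy of
`k P₄ ∪ t P₂`. -/
theorem hasRainbowCopy_linearForest {k t n r : ℕ} (hk : 1 ≤ k) (ht : 1 ≤ t)
    (hn : n = 4 * k + 2 * t) (c : TopEdgeLabeling (Fin n) (Fin r)) (hc : Function.Surjective c)
    (h1 : 4 * (2 * k + t : ℤ) ^ 2 - 14 * (2 * k + t) + 18 ≤ 2 * r)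
    (h2 : 3 * (2 * k + t : ℤ) ^ 2 - 5 * (2 * k + t) + 2 ≤ 2 * r) :
    HasRainbowCopy c (linearForestP4P2 k t) := by
  have hr : 0 < r := by
    by_contra hr
    have : r = 0 := by omega
    subst this
    have hk' : (1 : ℤ) ≤ k := by exact_mod_cast hk
    have ht' : (1 : ℤ) ≤ t := by exact_mod_cast ht
    push_cast at h2
    nlinarith
  have hmem : ∀ e : Sym2 (Fin n), ¬ e.IsDiag → e ∈ (⊤ : SimpleGraph (Fin n)).edgeSet := by
    intro e he
    simpa [edgeSet_top] using he
  let χ : Sym2 (Fin n) → Fin r := fun e => if h : ¬ e.IsDiag then c ⟨e, hmem e h⟩ else ⟨0, hr⟩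
  have hχ : ∀ e (h : e ∈ (⊤ : SimpleGraph (Fin n)).edgeSet), χ e = c ⟨e, h⟩ := by
    intro e h
    exact dif_pos (SimpleGraph.not_isDiag_of_mem_edgeSet _ h)
  have himg : (χ '' {e | ¬ e.IsDiag}).ncard = r := by
    have : χ '' {e | ¬ e.IsDiag} = Set.univ := by
      rw [Set.eq_univ_iff_forall]
      intro i
      obtain ⟨⟨e, he⟩, rfl⟩ := hc i
      exact ⟨e, SimpleGraph.not_isDiag_of_mem_edgeSet _ he, hχ e he⟩
    rw [this, Set.ncard_univ, Nat.card_fin]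
  have hV : Fintype.card (Fin n) = 2 * (2 * k + t) := by
    rw [Fintype.card_fin, hn]
    ring
  obtain ⟨G, hG, hGm⟩ := exists_isRepresenting_isMatchable (χ := χ) (s := 2 * k + t) (by omega) hV
    (by rw [himg]; push_cast; exact h1) (by rw [himg]; push_cast; exact h2)
  obtain ⟨f, hf, hfadj⟩ := exists_injective_linearForest (G := G) ht (by rw [hV]; ring) hGm (by
    rw [hG.card_adj, himg]
    push_cast
    exact h1)
  refine ⟨⟨⟨f, fun {x y} hxy => ?_⟩, hf⟩, ?_⟩
  · exact (hfadj x y hxy).ne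
  · rintro ⟨e, he⟩ ⟨e', he'⟩ hee
    have hGe : ∀ e ∈ (linearForestP4P2 k t).edgeSet, Sym2.map f e ∈ G.edgeSet := by
      intro e he
      induction e using Sym2.ind with
      | _ x y => exact hfadj x y he
    have h3 : χ (Sym2.map f e) = χ (Sym2.map f e') := by
      rw [hχ _ (hmem _ (SimpleGraph.not_isDiag_of_mem_edgeSet _ (hGe e he))),
        hχ _ (hmem _ (SimpleGraph.not_isDiag_of_mem_edgeSet _ (hGe e' he')))]
      exact hee
    exact Subtype.ext (Sym2.map.injective hf (hG.injOn (hGe e he) (hGe e' he') h3))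

end Embedding

/-! ### The two extremal colorings -/

section Lower

open scoped Classical

/-- A copy of `k P₄ ∪ t P₂` in the complete graph on `4 k + 2 t` vertices contains a perfect
matching, so a coloring without rainbow perfect matchings has no rainbow copy. -/
theorem ncard_mem_rainbowFreeColorCounts {K : Type*} {k t n : ℕ} (hn : n = 4 * k + 2 * t)
    (χ : Sym2 (Fin n) → K)
    (hχ : ∀ σ : Fin n → Fin n, (∀ v, σ (σ v) = v) → (∀ v, σ v ≠ v) →
      ∃ u v, s(u, σ u) ≠ s(v, σ v) ∧ χ s(u, σ u) = χ s(v, σ v)) :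
    (χ '' {e | ¬ e.IsDiag}).ncard ∈ rainbowFreeColorCounts n (linearForestP4P2 k t) := by
  let A : Set K := χ '' {e | ¬ e.IsDiag}
  have hA : A.Finite := Set.toFinite _
  have : Fintype A := hA.fintype
  have hAc : Fintype.card A = A.ncard := by rw [Set.ncard_eq_toFinset_card', Set.toFinset_card]
  let e : A ≃ Fin A.ncard := Fintype.equivFinOfCardEq hAc
  let c : TopEdgeLabeling (Fin n) (Fin A.ncard) := fun x =>
    e ⟨χ x.1, x.1, SimpleGraph.not_isDiag_of_mem_edgeSet _ x.2, rfl⟩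
  refine ⟨c, ?_, ?_⟩
  · intro i
    obtain ⟨⟨_, ⟨x, hx, rfl⟩⟩, rfl⟩ := e.surjective i
    exact ⟨⟨x, by simpa [edgeSet_top] using hx⟩, rfl⟩
  · rintro ⟨f, hf⟩
    have hbij : Function.Bijective f := by
      rw [Fintype.bijective_iff_injective_and_card]
      refine ⟨f.injective', ?_⟩
      simp only [Fintype.card_sum, Fintype.card_prod, Fintype.card_fin, hn]
      ring
    let F := Equiv.ofBijective f hbij
    -- The two end edges of each P₄, together with the copies of P₂, form the perfect matching.
    let h : Fin 4 → Fin 4 := ![1, 0, 3, 2]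
    let τ : (Fin k × Fin 4) ⊕ (Fin t × Fin 2) → (Fin k × Fin 4) ⊕ (Fin t × Fin 2) :=
      Sum.map (fun x => (x.1, h x.2)) (fun x => (x.1, x.2 + 1))
    have hh : ∀ x, h (h x) = x := by decide
    have hττ : ∀ x, τ (τ x) = x := by
      rintro (⟨l, x⟩ | ⟨l, x⟩)
      · simp [τ, hh]
      · have : x + 1 + 1 = x := by omega
        simp [τ, this]
    have hτ : ∀ x, (linearForestP4P2 k t).Adj x (τ x) := by
      rintro (⟨l, x⟩ | ⟨l, x⟩)
      · simp only [τ, Sum.map_inl, linearForestP4P2, nCopies, sum_adj, boxProd_adj, pathGraph_adj]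
        refine .inr ⟨?_, trivial⟩
        fin_cases x <;> simp [h]
      · simp only [τ, Sum.map_inr, linearForestP4P2, nCopies, sum_adj, boxProd_adj, pathGraph_adj]
        refine .inr ⟨?_, trivial⟩
        fin_cases x <;> simp
    obtain ⟨u, v, hne, heq⟩ := hχ (fun v => F (τ (F.symm v))) (by simp [hττ]) (by
      intro v hv
      have h1 : τ (F.symm v) = F.symm v := by
        rw [← F.symm_apply_apply (τ (F.symm v)), hv]
      have := (hτ (F.symm v)).ne
      exact this h1.symm)
    obtain ⟨x, rfl⟩ := F.surjective u
    obtain ⟨y, rfl⟩ := F.surjective v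
    simp only [Equiv.symm_apply_apply] at hne heq
    have h1 := @hf ⟨s(x, τ x), hτ x⟩ ⟨s(y, τ y), hτ y⟩ (by
      refine congrArg e (Subtype.ext ?_)
      exact heq)
    have h2 : s(x, τ x) = s(y, τ y) := congrArg Subtype.val h1
    apply hne
    have := congrArg (Sym2.map F) h2
    simpa using this

/-- The edges inside a finite set. -/
theorem ncard_edges_inside {V : Type*} (X : Finset V) :
    {e : Sym2 V | ¬ e.IsDiag ∧ ∀ v ∈ e, v ∈ X}.ncard = X.card.choose 2 := by
  rw [← Sym2.card_image_offDiag, ← Set.ncard_coe_finset]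
  congr 1
  ext e
  induction e using Sym2.ind with
  | _ a b =>
    simp only [Set.mem_ofPred_eq, Sym2.mk_isDiag_iff, Sym2.mem_iff, forall_eq_or_imp, forall_eq,
      Finset.coe_image, Set.mem_image, Finset.mem_coe, Finset.mem_offDiag, Prod.exists]
    constructor
    · rintro ⟨h1, h2, h3⟩
      exact ⟨a, b, ⟨h2, h3, h1⟩, rfl⟩
    · rintro ⟨x, y, ⟨h1, h2, h3⟩, hxy⟩
      rw [Function.uncurry_apply_pair, Sym2.eq_iff] at hxy
      rcases hxy with ⟨rfl, rfl⟩ | ⟨rfl, rfl⟩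
      · exact ⟨h3, h1, h2⟩
      · exact ⟨h3.symm, h2, h1⟩

/-- Give distinct colors to the edges that meet a set of `s - 2` vertices, and one further color to
all other edges. -/
theorem mem_rainbowFreeColorCounts_of_star {k t n : ℕ} (hk : 1 ≤ k)
    (hn : n = 4 * k + 2 * t) :
    n.choose 2 - (2 * k + t + 2).choose 2 + 1 ∈
      rainbowFreeColorCounts n (linearForestP4P2 k t) := by
  obtain ⟨I, -, hI⟩ := Finset.exists_subset_card_eq (s := (Finset.univ : Finset (Fin n)))
    (n := 2 * k + t + 2) (by rw [Finset.card_univ, Fintype.card_fin]; omega)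
  let χ : Sym2 (Fin n) → Option (Sym2 (Fin n)) := fun e => if ∀ v ∈ e, v ∈ I then none else some e
  have himg : (χ '' {e | ¬ e.IsDiag}).ncard = n.choose 2 - (2 * k + t + 2).choose 2 + 1 := by
    have h1 : χ '' {e | ¬ e.IsDiag} = insert none (some ''
        ({e | ¬ e.IsDiag} \ {e : Sym2 (Fin n) | ¬ e.IsDiag ∧ ∀ v ∈ e, v ∈ I})) := by
      ext x
      constructor
      · rintro ⟨e, he, rfl⟩
        by_cases h : ∀ v ∈ e, v ∈ I
        · exact .inl (if_pos h)
        · refine .inr ⟨e, ⟨he, fun hc => h hc.2⟩, (if_neg h).symm⟩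
      · rintro (rfl | ⟨e, he, rfl⟩)
        · obtain ⟨a, ha, b, hb, hab⟩ := Finset.one_lt_card.1 (show 1 < I.card by omega)
          exact ⟨s(a, b), by simpa using hab, if_pos (by simp [ha, hb])⟩
        · exact ⟨e, he.1, if_neg fun hc => he.2 ⟨he.1, hc⟩⟩
    have h2 : {e : Sym2 (Fin n) | ¬ e.IsDiag}.ncard = n.choose 2 := by
      have := ncard_edges_inside (Finset.univ : Finset (Fin n))
      simpa using this
    rw [h1, Set.ncard_insert_of_notMem (by simp), Set.ncard_image_of_injective _
      (Option.some_injective _), Set.ncard_sdiff (fun e he => he.1), ncard_edges_inside, hI, h2]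
  rw [← himg]
  refine ncard_mem_rainbowFreeColorCounts hn χ fun σ hσσ hσ => ?_
  have hinj : Function.Injective σ := fun a b hab => by rw [← hσσ a, hab, hσσ]
  -- At most `s - 2` of the `s + 2` vertices of `I` are matched to the outside. Of any three others,
  -- two lie on different edges inside `I`, both colored `none`.
  have h1 : (I.filter fun v => σ v ∉ I).card ≤ Iᶜ.card := by
    refine Finset.card_le_card_of_injOn σ ?_ hinj.injOn
    intro v hv
    simpa using (Finset.mem_filter.1 hv).2
  have h2 := Finset.card_filter_add_card_filter_not (s := I) fun v => σ v ∈ I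
  rw [Finset.card_compl, Fintype.card_fin] at h1
  obtain ⟨u, v, w, hu, hv, hw, huv, huw, hvw⟩ := Finset.two_lt_card_iff.1
    (show 2 < (I.filter fun v => σ v ∈ I).card by omega)
  rw [Finset.mem_filter] at hu hv hw
  have key : ∀ x ∈ I, σ x ∈ I → χ s(x, σ x) = none := fun x hx hx' => if_pos (by simp [hx, hx'])
  by_cases h3 : v = σ u
  · refine ⟨u, w, ?_, by rw [key u hu.1 hu.2, key w hw.1 hw.2]⟩
    rw [Ne, Sym2.eq_iff]
    rintro (h | h)
    · exact huw h.1
    · exact hvw (h3.trans h.2)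
  · refine ⟨u, v, ?_, by rw [key u hu.1 hu.2, key v hv.1 hv.2]⟩
    rw [Ne, Sym2.eq_iff]
    rintro (h | h)
    · exact huv h.1
    · exact h3 h.2.symm

/-- Give distinct colors to the edges inside a set of `n - 3` vertices, and two further colors to
the other edges. -/
theorem mem_rainbowFreeColorCounts_of_clique {k t n : ℕ} (hk : 1 ≤ k) (ht : 1 ≤ t)
    (hn : n = 4 * k + 2 * t) :
    (n - 3).choose 2 + 2 ∈ rainbowFreeColorCounts n (linearForestP4P2 k t) := by
  obtain ⟨X, -, hX⟩ := Finset.exists_subset_card_eq (s := (Finset.univ : Finset (Fin n)))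
    (n := 3) (by rw [Finset.card_univ, Fintype.card_fin]; omega)
  obtain ⟨a, b, d, hab, had, hbd, rfl⟩ := Finset.card_eq_three.1 hX
  let Y : Finset (Fin n) := ({a, b, d} : Finset (Fin n))ᶜ
  have hY : ∀ v, v ∈ Y ↔ v ≠ a ∧ v ≠ b ∧ v ≠ d := fun v => by simp [Y]
  -- A perfect matching containing `ab` also has an edge from `d` to `Y`, and `q` holds for both. In
  -- any other, the edges at `a` and at `b` are distinct, and `q` fails for both.
  let q : Sym2 (Fin n) → Prop := fun e => e = s(a, b) ∨ ∃ y ∈ Y, e = s(d, y)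
  let χ : Sym2 (Fin n) → Sym2 (Fin n) ⊕ Prop := fun e =>
    if ∀ v ∈ e, v ∈ Y then .inl e else .inr (q e)
  have hqad : ¬ q s(a, d) := by
    rintro (h | ⟨y, hy, h⟩)
    · simp [hbd.symm, hab] at h
    · rw [hY] at hy
      simp [had, hy.1.symm] at h
  have himg : (χ '' {e | ¬ e.IsDiag}).ncard = (n - 3).choose 2 + 2 := by
    have h1 : χ '' {e | ¬ e.IsDiag} = insert (.inr True) (insert (.inr False) (Sum.inl ''
        {e : Sym2 (Fin n) | ¬ e.IsDiag ∧ ∀ v ∈ e, v ∈ Y})) := by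
      ext x
      constructor
      · rintro ⟨e, he, rfl⟩
        by_cases h : ∀ v ∈ e, v ∈ Y
        · exact .inr (.inr ⟨e, ⟨he, h⟩, (if_pos h).symm⟩)
        · have h3 : χ e = .inr (q e) := if_neg h
          rw [h3]
          by_cases hq : q e
          · left
            rw [eq_true hq]
          · right
            left
            rw [eq_false hq]
      · rintro (rfl | rfl | ⟨e, he, rfl⟩)
        · refine ⟨s(a, b), by simpa using hab, ?_⟩
          have : q s(a, b) := .inl rfl
          rw [← eq_true this]
          exact if_neg fun h => by simpa [hY] using h a (by simp)
        · refine ⟨s(a, d), by simpa using had, ?_⟩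
          rw [← eq_false hqad]
          exact if_neg fun h => by simpa [hY] using h a (by simp)
        · exact ⟨e, he.1, if_pos he.2⟩
    rw [h1, Set.ncard_insert_of_notMem (by simp), Set.ncard_insert_of_notMem (by simp),
      Set.ncard_image_of_injective _ Sum.inl_injective, ncard_edges_inside, Finset.card_compl, hX,
      Fintype.card_fin]
  rw [← himg]
  refine ncard_mem_rainbowFreeColorCounts hn χ fun σ hσσ hσ => ?_
  have htrue : ∀ x y, x ∉ Y → q s(x, y) → χ s(x, y) = .inr True := by
    intro x y hx hq
    have h : χ s(x, y) = .inr (q s(x, y)) := if_neg fun h => hx (h x (by simp))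
    rw [h, eq_true hq]
  have hfalse : ∀ x y, x ∉ Y → ¬ q s(x, y) → χ s(x, y) = .inr False := by
    intro x y hx hq
    have h : χ s(x, y) = .inr (q s(x, y)) := if_neg fun h => hx (h x (by simp))
    rw [h, eq_false hq]
  have ha : a ∉ Y := by simp [hY]
  have hb : b ∉ Y := by simp [hY]
  have hd : d ∉ Y := by simp [hY]
  have hqa : ∀ y ∈ Y, ¬ q s(a, y) := by
    rintro y hy (h | ⟨y', hy', h⟩)
    · rw [hY] at hy
      simp [hy, hab] at h
    · rw [hY] at hy'
      simp [had, hy'.1.symm] at h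
  have hqb : ∀ y ∈ Y, ¬ q s(b, y) := by
    rintro y hy (h | ⟨y', hy', h⟩)
    · rw [hY] at hy
      simp [hy, hab.symm] at h
    · rw [hY] at hy'
      simp [hbd, hy'.2.1.symm] at h
  have hqbd : ¬ q s(b, d) := by
    rintro (h | ⟨y, hy, h⟩)
    · simp [had.symm, hab.symm] at h
    · rw [hY] at hy
      simp [hbd, hy.2.1.symm] at h
  have hinj : Function.Injective σ := fun x y hxy => by rw [← hσσ x, hxy, hσσ]
  have hout : ∀ x y, σ x ≠ y → σ y ≠ x := fun x y h hc => h (by rw [← hc, hσσ])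
  by_cases hσab : σ a = b
  · have hσb : σ b = a := by rw [← hσab, hσσ]
    have hσd : σ d ∈ Y := by
      rw [hY]
      refine ⟨fun h => ?_, fun h => ?_, hσ d⟩
      · exact hbd (hinj (hσb.trans h.symm))
      · exact had (hinj (hσab.trans h.symm))
    refine ⟨a, d, ?_, ?_⟩
    · rw [Ne, Sym2.eq_iff]
      rintro (h | h)
      · exact had h.1
      · exact hbd (hσab ▸ h.2)
    · rw [htrue a _ ha (.inl (by rw [hσab])), htrue d _ hd (.inr ⟨_, hσd, rfl⟩)]
  have hσba : σ b ≠ a := hout a b hσab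
  by_cases hσad : σ a = d
  · have hσb : σ b ∈ Y := by
      rw [hY]
      refine ⟨hσba, hσ b, fun h => ?_⟩
      exact hab (hinj (hσad.trans h.symm))
    refine ⟨a, b, ?_, ?_⟩
    · rw [Ne, Sym2.eq_iff]
      rintro (h | h)
      · exact hab h.1
      · exact hσba h.1.symm
    · rw [hfalse a _ ha (by rwa [hσad]), hfalse b _ hb (hqb _ hσb)]
  have hσa : σ a ∈ Y := (hY _).2 ⟨hσ a, hσab, hσad⟩
  refine ⟨a, b, ?_, ?_⟩
  · rw [Ne, Sym2.eq_iff]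
    rintro (h | h)
    · exact hab h.1
    · exact hσba h.1.symm
  · rw [hfalse a _ ha (hqa _ hσa)]
    by_cases hσbd : σ b = d
    · rw [hfalse b _ hb (by rwa [hσbd])]
    · rw [hfalse b _ hb (hqb _ ((hY _).2 ⟨hσba, hσ b, hσbd⟩))]

end Lower

theorem corollary2 (k t n : ℕ) (hk : 1 ≤ k) (ht : 1 ≤ t) (hn : n = 4 * k + 2 * t) :
    (2 * k + t ≤ 6 →
      (antiRamsey n (linearForestP4P2 k t) : ℚ) =
        1 / 2 * (2 * (k : ℚ) + t - 2) * (6 * (k : ℚ) + 3 * t + 1) + 1) ∧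
    (7 ≤ 2 * k + t →
      (antiRamsey n (linearForestP4P2 k t) : ℚ) =
        (2 * (k : ℚ) + t - 2) * (4 * (k : ℚ) + 2 * t - 3) + 2) := by
  -- The left-hand sides are `2(x + 1)` with `x` the number of colors of the clique and of the star
  -- coloring, so `m` has only to be the larger of the two.
  have hgreatest : ∀ m, m ∈ rainbowFreeColorCounts n (linearForestP4P2 k t) →
      4 * (2 * k + t : ℤ) ^ 2 - 14 * (2 * k + t) + 18 ≤ 2 * (m + 1) →
      3 * (2 * k + t : ℤ) ^ 2 - 5 * (2 * k + t) + 2 ≤ 2 * (m + 1) →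
      antiRamsey n (linearForestP4P2 k t) = m := by
    intro m hm h1 h2
    refine IsGreatest.csSup_eq ⟨hm, ?_⟩
    rintro r ⟨c, hc, hrb⟩
    by_contra! hlt
    have hlt' : (m : ℤ) + 1 ≤ r := by exact_mod_cast hlt
    exact hrb (hasRainbowCopy_linearForest hk ht hn c hc (by linarith) (by linarith))
  have hchoose : ∀ x : ℕ, ((x.choose 2 : ℕ) : ℚ) = x * (x - 1) / 2 := fun x =>
    Nat.cast_choose_two ℚ x
  refine ⟨fun hs => ?_, fun hs => ?_⟩
  · have hmem := mem_rainbowFreeColorCounts_of_star hk hn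
    have hle : (2 * k + t + 2).choose 2 ≤ n.choose 2 := Nat.choose_le_choose 2 (by omega)
    set m := n.choose 2 - (2 * k + t + 2).choose 2 + 1 with hm
    have hmq : (m : ℚ) = 1 / 2 * (2 * (k : ℚ) + t - 2) * (6 * (k : ℚ) + 3 * t + 1) + 1 := by
      rw [hm, Nat.cast_add, Nat.cast_sub hle, hchoose, hchoose, hn]
      push_cast
      ring
    have hmz : 2 * (m : ℤ) = (2 * k + t - 2) * (6 * k + 3 * t + 1) + 2 := by
      have : 2 * (m : ℚ) = (2 * k + t - 2) * (6 * k + 3 * t + 1) + 2 := by rw [hmq]; ring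
      exact_mod_cast this
    rw [hgreatest m hmem ?_ ?_, hmq]
    · have h3 : (3 : ℤ) ≤ 2 * k + t := by exact_mod_cast (by omega : 3 ≤ 2 * k + t)
      have h6 : (2 * k + t : ℤ) ≤ 6 := by exact_mod_cast hs
      -- The quadratic `s² - 9s + 16` comparing the two colorings equals `(s - 3)(s - 6) - 2`.
      nlinarith [mul_nonneg (sub_nonneg.2 h3) (sub_nonneg.2 h6)]
    · nlinarith
  · have hmem := mem_rainbowFreeColorCounts_of_clique hk ht hn
    set m := (n - 3).choose 2 + 2 with hm
    have hmq : (m : ℚ) = (2 * (k : ℚ) + t - 2) * (4 * (k : ℚ) + 2 * t - 3) + 2 := by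
      rw [hm, Nat.cast_add, hchoose, Nat.cast_sub (by omega), hn]
      push_cast
      ring
    have hmz : (m : ℤ) = (2 * k + t - 2) * (4 * k + 2 * t - 3) + 2 := by
      exact_mod_cast hmq
    rw [hgreatest m hmem ?_ ?_, hmq]
    · nlinarith
    · have h7 : (7 : ℤ) ≤ 2 * k + t := by exact_mod_cast hs
      nlinarith
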